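/- All systems are finite-dimensional; $|A|$ is the dimension of $A$, $\mathcal D_A$ the set of density operators on $A$, $\pi_A=\mathbb 1_A/|A|$ the uniform state, $\rho_B=\mathrm{Tr}_A\rho_{AB}$, $\Delta(\rho,\sigma)=\tfrac12\|\rho-\sigma\|_1$ the trace distance, and $|0\rangle\langle 0|_A$ a fixed pure basis state of $A$. Alice holds $A,A',A_0,A_1$ (all with trivial Hamiltonians) and Bob holds $B,B',B''$. *Free operations.* A channel $\mathcal N_{AB\to A'B'}$ is conditionally uniformity covariant (CUCO) if there are a system $B''$ and channels $\mathcal E_{B\to B'B''}$, $\mathcal F_{AB''\to A'}$ with $\mathcal N=\mathcal F\circ\mathcal E$ and $\mathcal F[\pi_A\otimes\rho_{B''}]=\pi_{A'}$ for every $\rho_{B''}\in\mathcal D_{B''}$. *Work costs.* Let $\beta>0$ (with $\beta=1/(kT\ln 2)$). For $\varepsilon\in[0,1]$ and states $\rho_{AB},\sigma_{A'B'}$ put $$W^\varepsilon(\rho_{AB};\sigma_{A'B'})=\frac1\beta\inf\big\{\log_2|A_0|-\log_2|A_1|\big\},$$ the infimum being over all systems $A_0,A_1$ and all CUCO channels $\mathcal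 N_{A_0AB\to A_1A'B'}$ such that $\Delta\big(|0\rangle\langle0|_{A_1}\otimes\sigma_{A'B'},\ \mathcal N[|0\rangle\langle0|_{A_0}\otimes\rho_{AB}]\big)\le\varepsilon$. The costs of preparing and of erasing $A$ are $W^\varepsilon_{\rm prep}(\rho_{AB})=W^\varepsilon(|0\rangle\langle0|_A;\rho_{AB})$ and $W^\varepsilon_{\rm eras}(\rho_{AB})=W^\varepsilon(\rho_{AB};|0\rangle\langle0|_A)$, where Bob's initial, respectively final, system is trivial. *Entropies.* Let $D_{\max}(\rho\|\sigma)=\log_2\|\sigma^{-1/2}\rho\,\sigma^{-1/2}\|_\infty$ if $\mathrm{supp}\,\rho\subseteq\mathrm{supp}\,\sigma$ (inverse on the support) and $+\infty$ otherwise; $D_{\min}(\rho\|\sigma)=-\log_2\mathrm{Tr}[\rho^0\sigma]$ with $\rho^0$ the projector onto $\mathrm{supp}\,\rho$; and $D_{\min}^\varepsilon(\rho\|\sigma)=\sup\{-\log_2\mathrm{Tr}[\Lambda\sigma]:0\le\Lambda\le\mathbb 1,\ \mathrm{Tr}[\Lambda\rho]\ge1-\varepsilon\}$. Define $$H_{\min}^{\downarrow}(A|B)_\rho=\log_2|A|-D_{\max}(\rho_{AB}\|\pi_A\otimes\rho_B),\qquad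 H_{\max}^{\uparrow}(A|B)_\rho=\log_2|A|-\inf_{\sigma_B\in\mathcal D_B}D_{\min}(\rho_{AB}\|\pi_A\otimes\sigma_B),$$ $$H_{\min}^{\downarrow,\varepsilon}(A|B)_\rho=\sup\big\{H_{\min}^{\downarrow}(A'|B)_\tau:\ |A'|\ge|A|,\ \tau_{A'B}\in\mathcal D_{A'B},\ \Delta(\rho_{A'B},\tau_{A'B})\le\varepsilon\big\},$$ where $\rho_{A'B}$ is the image of $\rho_{AB}$ under an embedding of $A$ into $A'$ (the choice is immaterial), and $$H_{\max}^{\uparrow,\varepsilon}(A|B)_\rho=\log_2|A|-\inf_{\sigma_B\in\mathcal D_B}D_{\min}^{\varepsilon}(\rho_{AB}\|\pi_A\otimes\sigma_B).$$ All quantities take values in $[-\infty,+\infty]$, with $\log_20=-\infty$. **Theorem.** For every state $\rho_{AB}$ and every $\varepsilon\in[0,1]$, $$W^\varepsilon_{\rm prep}(\rho_{AB})=-\frac1\beta H_{\min}^{\downarrow,\varepsilon}(A|B)_\rho,\qquad W^\varepsilon_{\rm eras}(\rho_{AB})=\frac1\beta H_{\max}^{\uparrow,\varepsilon}(A|B)_\rho.$$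 For $\varepsilon=0$, $$W^0_{\rm prep}(\rho_{AB})=-\frac1\beta H_{\min}^{\downarrow}(A|B)_\rho,\qquad W^0_{\rm eras}(\rho_{AB})=\frac1\beta H_{\max}^{\uparrow}(A|B)_\rho.$$ -/

import Mathlib

open scoped MatrixOrder ComplexOrder Kronecker

noncomputable section

namespace QThermo

/-! A quantum system is a finite type `n` labelling an orthonormal basis of its Hilbert space `ℂⁿ`;
a joint system `AB` is the product `A × B`; operators are complex matrices. -/

universe u v w x

/-! ### States, partial traces, channels -/

/-- Density operators. -/
def IsState {n : Type u} [Fintype n] (ρ : Matrix n n ℂ) : Prop :=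
  ρ.PosSemidef ∧ ρ.trace = 1

/-- The pure state `|x⟩⟨x|` of the basis vector labelled `x`. -/
def ket {n : Type u} [DecidableEq n] (x : n) : Matrix n n ℂ :=
  Matrix.single x x 1

/-- The uniform state `π_A = 𝟙 / |A|`. -/
def uniform (A : Type u) [Fintype A] [DecidableEq A] : Matrix A A ℂ :=
  (Fintype.card A : ℂ)⁻¹ • (1 : Matrix A A ℂ)

/-- The partial trace over the first factor, `Tr_A : M_{AB} → M_B`. -/
def trFst {A : Type u} {B : Type v} [Fintype A] (M : Matrix (A × B) (A × B) ℂ) : Matrix B B ℂ :=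
  Matrix.of fun b b' => ∑ a, M (a, b) (a, b')

/-- `id_R ⊗ Φ`. -/
def idTensor {a : Type u} {b : Type v} (R : Type w)
    (Φ : Matrix a a ℂ →ₗ[ℂ] Matrix b b ℂ) (M : Matrix (R × a) (R × a) ℂ) :
    Matrix (R × b) (R × b) ℂ :=
  Matrix.of fun p q => Φ (Matrix.of fun y y' => M (p.1, y) (q.1, y')) p.2 q.2

/-- `Φ ⊗ id_R`. -/
def tensorId {a : Type u} {b : Type v} (R : Type w)
    (Φ : Matrix a a ℂ →ₗ[ℂ] Matrix b b ℂ) (M : Matrix (a × R) (a × R) ℂ) :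
    Matrix (b × R) (b × R) ℂ :=
  Matrix.of fun p q => Φ (Matrix.of fun y y' => M (y, p.2) (y', q.2)) p.1 q.1

/-- Quantum channels: completely positive and trace-preserving linear maps. -/
structure IsChannel {a : Type u} {b : Type v} [Fintype a] [Fintype b]
    (Φ : Matrix a a ℂ →ₗ[ℂ] Matrix b b ℂ) : Prop where
  completelyPositive : ∀ (k : ℕ) (M : Matrix (Fin k × a) (Fin k × a) ℂ),
    M.PosSemidef → (idTensor (Fin k) Φ M).PosSemidef
  tracePreserving : ∀ M : Matrix a a ℂ, (Φ M).trace = M.trace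

/-! ### Conditionally uniformity-covariant operations -/

/-- `N_{AB → A'B'}` is conditionally uniformity covariant (a free operation): Bob applies a channel
`E_{B → B''B'}` and sends the (finite-dimensional) system `B''` to Alice, who applies a channel
`F_{AB'' → A'}` with `F[π_A ⊗ ρ] = π_{A'}` for every state `ρ` of `B''`. The map `N`, being a
composition of channels, is then a channel. -/
def IsCUCO {A : Type u} {B : Type v} {A' : Type w} {B' : Type x}
    [Fintype A] [DecidableEq A] [Fintype B] [Fintype A'] [DecidableEq A'] [Fintype B']
    (N : Matrix (A × B) (A × B) ℂ →ₗ[ℂ] Matrix (A' × B') (A' × B') ℂ) : Prop :=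
  ∃ (k : ℕ) (E : Matrix B B ℂ →ₗ[ℂ] Matrix (Fin k × B') (Fin k × B') ℂ)
    (F : Matrix (A × Fin k) (A × Fin k) ℂ →ₗ[ℂ] Matrix A' A' ℂ),
    IsChannel E ∧ IsChannel F ∧
    (∀ M : Matrix (A × B) (A × B) ℂ,
      N M = tensorId B' F
        (Matrix.reindex (Equiv.prodAssoc A (Fin k) B').symm (Equiv.prodAssoc A (Fin k) B').symm
          (idTensor A E M))) ∧
    (∀ ρ : Matrix (Fin k) (Fin k) ℂ, IsState ρ → F (uniform A ⊗ₖ ρ) = uniform A')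

/-! ### Distances and entropies -/

/-- The trace distance `½ ‖ρ - σ‖₁`, where `‖X‖₁ = Tr |X|`. -/
def traceDist {n : Type u} [Fintype n] [DecidableEq n] (ρ σ : Matrix n n ℂ) : ℝ :=
  (1 / 2) * (CFC.abs (ρ - σ)).trace.re

/-- The operator norm of a matrix with respect to the Euclidean norm on `ℂⁿ`. -/
def opNorm {n : Type u} [Fintype n] [DecidableEq n] (M : Matrix n n ℂ) : ℝ :=
  ‖Matrix.toEuclideanCLM (𝕜 := ℂ) M‖

/-- The base-two logarithm of a nonnegative real, with `log₂ 0 = -∞`. -/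
def elog2 (t : ℝ) : EReal :=
  if t ≤ 0 then ⊥ else ((Real.logb 2 t : ℝ) : EReal)

/-- `σ^{-1/2}`, inverted on the support of the positive semidefinite matrix `σ`. -/
def invSqrt {n : Type u} [Fintype n] [DecidableEq n] (σ : Matrix n n ℂ) : Matrix n n ℂ :=
  cfc (fun t : ℝ => (Real.sqrt t)⁻¹) σ

/-- `ρ⁰`, the projector onto the support of the Hermitian matrix `ρ`. -/
def supportProj {n : Type u} [Fintype n] [DecidableEq n] (ρ : Matrix n n ℂ) : Matrix n n ℂ :=
  cfc (fun t : ℝ => if t = 0 then 0 else 1) ρ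

open Classical in
/-- The max-relative entropy `log₂ ‖σ^{-1/2} ρ σ^{-1/2}‖_∞` if `supp ρ ⊆ supp σ` (stated as
`ker σ ⊆ ker ρ`), and `+∞` otherwise. -/
def Dmax {n : Type u} [Fintype n] [DecidableEq n] (ρ σ : Matrix n n ℂ) : EReal :=
  if ∀ v : n → ℂ, σ.mulVec v = 0 → ρ.mulVec v = 0 then
    elog2 (opNorm (invSqrt σ * ρ * invSqrt σ))
  else ⊤

/-- The min-relative entropy `-log₂ Tr[ρ⁰ σ]`. -/
def Dmin {n : Type u} [Fintype n] [DecidableEq n] (ρ σ : Matrix n n ℂ) : EReal :=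
  -elog2 ((supportProj ρ * σ).trace.re)

/-- The smoothed min-relative entropy: the supremum of `-log₂ Tr[Λ σ]` over `0 ≤ Λ ≤ 𝟙` with
`Tr[Λ ρ] ≥ 1 - ε`. -/
def DminSmooth {n : Type u} [Fintype n] [DecidableEq n] (ε : ℝ) (ρ σ : Matrix n n ℂ) : EReal :=
  sSup {d : EReal | ∃ Λ : Matrix n n ℂ, 0 ≤ Λ ∧ Λ ≤ 1 ∧ 1 - ε ≤ (Λ * ρ).trace.re ∧
    d = -elog2 ((Λ * σ).trace.re)}

section Entropies

variable {A : Type u} {B : Type v} [Fintype A] [DecidableEq A] [Fintype B] [DecidableEq B]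

/-- The conditional min-entropy `log₂ |A| - D_max(ρ_AB ‖ π_A ⊗ ρ_B)`. -/
def HminDown (ρ : Matrix (A × B) (A × B) ℂ) : EReal :=
  elog2 (Fintype.card A) - Dmax ρ (uniform A ⊗ₖ trFst ρ)

/-- The conditional max-entropy `log₂ |A| - inf_σ D_min(ρ_AB ‖ π_A ⊗ σ_B)`. -/
def HmaxUp (ρ : Matrix (A × B) (A × B) ℂ) : EReal :=
  elog2 (Fintype.card A) -
    sInf {d : EReal | ∃ σ : Matrix B B ℂ, IsState σ ∧ d = Dmin ρ (uniform A ⊗ₖ σ)}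

/-- The image of `ρ_AB` under the isometric embedding `|a⟩ ↦ |f a⟩` of `A` into `A'`. -/
def embed {A' : Type w} [DecidableEq A'] (f : A ↪ A') (ρ : Matrix (A × B) (A × B) ℂ) :
    Matrix (A' × B) (A' × B) ℂ :=
  let V : Matrix A' A ℂ := Matrix.of fun i a => if i = f a then 1 else 0
  (V ⊗ₖ (1 : Matrix B B ℂ)) * ρ * (V ⊗ₖ (1 : Matrix B B ℂ)).conjTranspose

/-- The smoothed conditional min-entropy: the supremum of `H_min(A'|B)_τ` over all systems `A'`
into which `A` embeds (so `|A'| ≥ |A|`) and all states `τ_{A'B}` that are `ε`-close in trace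
distance to the embedded `ρ_{A'B}`. The value for a given `A'` does not depend on the embedding. -/
def HminDownSmooth (ε : ℝ) (ρ : Matrix (A × B) (A × B) ℂ) : EReal :=
  sSup {h : EReal | ∃ (m : ℕ) (f : A ↪ Fin m) (τ : Matrix (Fin m × B) (Fin m × B) ℂ),
    IsState τ ∧ traceDist (embed f ρ) τ ≤ ε ∧ h = HminDown τ}

/-- The smoothed conditional max-entropy `log₂ |A| - inf_σ D_min^ε(ρ_AB ‖ π_A ⊗ σ_B)`. -/
def HmaxUpSmooth (ε : ℝ) (ρ : Matrix (A × B) (A × B) ℂ) : EReal :=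
  elog2 (Fintype.card A) -
    sInf {d : EReal | ∃ σ : Matrix B B ℂ, IsState σ ∧ d = DminSmooth ε ρ (uniform A ⊗ₖ σ)}

end Entropies

/-! ### Work costs -/

section Work

variable {A : Type u} {B : Type v} {A' : Type w} {B' : Type x}
  [Fintype A] [DecidableEq A] [Fintype B] [DecidableEq B]
  [Fintype A'] [DecidableEq A'] [Fintype B'] [DecidableEq B']

/-- `|0⟩⟨0|_{A₀} ⊗ ρ_AB` for a battery `A₀` of dimension `m ≥ 1`, as an operator on `(A₀A)B`. -/
def withBattery (m : ℕ) [NeZero m] (ρ : Matrix (A × B) (A × B) ℂ) :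
    Matrix ((Fin m × A) × B) ((Fin m × A) × B) ℂ :=
  Matrix.reindex (Equiv.prodAssoc (Fin m) A B).symm (Equiv.prodAssoc (Fin m) A B).symm
    (ket (0 : Fin m) ⊗ₖ ρ)

/-- The one-shot work cost of converting `ρ_AB` into `σ_{A'B'}` with error `ε`: `1/β` times the
infimum of `log₂ |A₀| - log₂ |A₁|` over all batteries `A₀`, `A₁` (of dimensions `m`, `n`) and all
conditionally uniformity-covariant `N_{A₀AB → A₁A'B'}` that achieve the conversion up to `ε`. -/
def workCost (β ε : ℝ) (ρ : Matrix (A × B) (A × B) ℂ) (σ : Matrix (A' × B') (A' × B') ℂ) :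
    EReal :=
  ((1 / β : ℝ) : EReal) * sInf {c : EReal | ∃ (m n : ℕ) (_ : NeZero m) (_ : NeZero n)
    (N : Matrix ((Fin m × A) × B) ((Fin m × A) × B) ℂ →ₗ[ℂ]
      Matrix ((Fin n × A') × B') ((Fin n × A') × B') ℂ),
    IsCUCO N ∧ traceDist (withBattery n σ) (N (withBattery m ρ)) ≤ ε ∧
    c = ((Real.logb 2 m - Real.logb 2 n : ℝ) : EReal)}

/-- The one-shot work cost of preparing `ρ_AB` from the default pure state `|a₀⟩⟨a₀|_A`, Bob's
initial system being trivial. -/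
def prepCost (β ε : ℝ) (a₀ : A) (ρ : Matrix (A × B) (A × B) ℂ) : EReal :=
  workCost β ε (ket ((a₀, ()) : A × Unit)) ρ

/-- The one-shot work cost of erasing `A` in the state `ρ_AB` to the default pure state
`|a₀⟩⟨a₀|_A`, Bob's final system being trivial. -/
def erasCost (β ε : ℝ) (a₀ : A) (ρ : Matrix (A × B) (A × B) ℂ) : EReal :=
  workCost β ε ρ (ket ((a₀, ()) : A × Unit))

end Work

end QThermo

end

/-!
Both work costs are computed by comparing the input and the output of a free operation with the
uniform state.

**Preparation.** A pure state of Alice's initial system `P` is at most `|P| π_P`. A free operation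
is positive, maps `π_P` (Bob's initial system being trivial) to `π_Q ⊗ τ_B`, and lets no signal pass
from Alice to Bob, so each state `τ` it prepares satisfies `τ ≤ |P| π_Q ⊗ τ_B`
(`IsCUCO.le_HminDown`). Conversely, whenever this inequality holds, Bob prepares the canonical
purification of `τ_B` and sends the purifying system to Alice. She tests whether her own system is
in the initial pure state. If it is, she applies the channel whose Choi matrix is `τ_B^{-1/2} τ
τ_B^{-1/2}`, which steers the purification to `τ`. If it is not, she applies the channel that makes
the average over a uniform input uniform again; the inequality is exactly what makes this second
channel completely positive (`exists_isCUCO_prepare`). Since `H_min(A|B)_τ ≥ c` means `τ ≤ 2^{-c} 𝟙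
⊗ τ_B` (`coe_le_HminDown_iff`), which is insensitive to isometric embeddings of Alice's system, and
ratios `m / n` of battery dimensions are dense, the work cost is `-H_min`.

**Erasure.** Pulling the projector on the target state back through a free operation gives a test
`Λ` on `AB` that accepts `ρ` with probability at least `1 - ε`, and preservation of uniformity
bounds `Tr[Λ (𝟙 ⊗ σ)]` by the ratio `m / n` of battery dimensions for every state `σ` of Bob
(`IsCUCO.exists_test_mem`). Conversely, a test with this bound is completed, on the orthogonal
complement of the initial battery state, by a test of Bob's system alone such that a uniform input
is accepted with the right probability whatever Bob's state is; performing this test and preparing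
the target state or its uniform complement is a free operation (`exists_isCUCO_erase`). The order of
the quantifiers over `Λ` and `σ` differs from that in the definition of `H_max`, and Sion's minimax
theorem exchanges them (`exists_test_forall_state`).

**Vanishing error.** At `ε = 0` smoothing is void: states at trace distance zero coincide, and a test
that accepts `ρ` with certainty dominates the support projector of `ρ`
(`supportProj_le_of_one_le_trace`).
-/

open scoped MatrixOrder ComplexOrder Kronecker

noncomputable section

namespace QThermo

open Matrix

universe u v w x

/-! ### Trace distance and operator norm -/

section MatrixAnalysis
variable {n : Type u} [Fintype n] [DecidableEq n]

theorem trace_mul_nonneg {M N : Matrix n n ℂ} (hM : M.PosSemidef) (hN : N.PosSemidef) :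
    0 ≤ (M * N).trace := by
  obtain ⟨C, rfl⟩ := CStarAlgebra.nonneg_iff_eq_star_mul_self.mp hN.nonneg
  rw [← mul_assoc, trace_mul_comm, ← mul_assoc]
  exact (hM.mul_mul_conjTranspose_same C).trace_nonneg

theorem trace_mul_re_nonneg {M N : Matrix n n ℂ} (hM : M.PosSemidef) (hN : N.PosSemidef) :
    0 ≤ (M * N).trace.re := (Complex.le_def.mp (trace_mul_nonneg hM hN)).1

omit [DecidableEq n] in
theorem trace_re_nonneg {M : Matrix n n ℂ} (hM : M.PosSemidef) : 0 ≤ M.trace.re :=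
  (Complex.le_def.mp hM.trace_nonneg).1

theorem trace_mul_re_le {M N K : Matrix n n ℂ} (h : M ≤ N) (hK : K.PosSemidef) :
    (M * K).trace.re ≤ (N * K).trace.re := by
  have := trace_mul_re_nonneg (Matrix.le_iff.mp h) hK
  rw [sub_mul, trace_sub, Complex.sub_re] at this
  linarith

/-- Functions on the spectrum of a matrix are continuous, the spectrum being finite. -/
theorem continuousOn_spectrum (M : Matrix n n ℂ) (f : ℝ → ℝ) :
    ContinuousOn f (spectrum ℝ M) := by
  have : Finite (spectrum ℝ M) := Matrix.finite_real_spectrum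
  exact (Set.toFinite _).continuousOn f

/-- Any decomposition of `ρ - σ` into positive parts bounds the trace distance. -/
theorem traceDist_le_of_sub_eq {ρ σ P Q : Matrix n n ℂ} (hP : P.PosSemidef) (hQ : Q.PosSemidef)
    (h : ρ - σ = P - Q) : traceDist ρ σ ≤ (P.trace.re + Q.trace.re) / 2 := by
  have hX : IsSelfAdjoint (P - Q) := (hP.1.sub hQ.1)
  have hc := continuousOn_spectrum (P - Q)
  set S := cfc (fun t : ℝ => if 0 ≤ t then (1 : ℝ) else -1) (P - Q) with hS
  -- `S` is the sign of `P - Q`, so that `-𝟙 ≤ S ≤ 𝟙`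
  have habs : CFC.abs (P - Q) = S * (P - Q) := by
    rw [CFC.abs_eq_cfc_norm (P - Q)]
    conv_rhs => rw [hS]; arg 2; rw [← cfc_id' ℝ (P - Q)]
    rw [← cfc_mul _ _ _ (hc _) (hc _)]
    refine cfc_congr fun t _ => ?_
    simp only [Real.norm_eq_abs]
    split_ifs with ht
    · rw [abs_of_nonneg ht, one_mul]
    · rw [abs_of_neg (not_le.mp ht), neg_one_mul]
  have h1 : S ≤ 1 := by
    refine cfc_le_one _ _ fun t _ => ?_
    split_ifs <;> norm_num
  have h2 : -1 ≤ S := by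
    have : (-1 : Matrix n n ℂ) = cfc (fun _ : ℝ => (-1 : ℝ)) (P - Q) := by
      rw [cfc_const (-1 : ℝ) (P - Q)]; simp
    rw [this]
    refine cfc_mono (fun t _ => ?_) (hc _) (hc _)
    split_ifs <;> norm_num
  have e1 := trace_mul_re_le h1 hP
  have e2 := trace_mul_re_le h2 hQ
  rw [traceDist, h, habs, mul_sub, trace_sub, Complex.sub_re]
  simp only [one_mul, neg_mul, trace_neg, Complex.neg_re] at e1 e2
  linarith

/-- The Jordan decomposition of `ρ - σ` realises the trace distance. -/
theorem exists_sub_eq_traceDist {ρ σ : Matrix n n ℂ} (hρ : ρ.IsHermitian) (hσ : σ.IsHermitian) :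
    ∃ P Q : Matrix n n ℂ, P.PosSemidef ∧ Q.PosSemidef ∧ ρ - σ = P - Q ∧
      traceDist ρ σ = (P.trace.re + Q.trace.re) / 2 := by
  have hX : IsSelfAdjoint (ρ - σ) := hρ.sub hσ
  refine ⟨(ρ - σ)⁺, (ρ - σ)⁻, (CFC.posPart_nonneg _).posSemidef,
    (CFC.negPart_nonneg _).posSemidef, (CFC.posPart_sub_negPart _ hX).symm, ?_⟩
  rw [traceDist, ← CFC.posPart_add_negPart (ρ - σ) hX, trace_add, Complex.add_re]
  ring

theorem eq_of_traceDist_le_zero {ρ σ : Matrix n n ℂ} (hρ : ρ.IsHermitian) (hσ : σ.IsHermitian)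
    (h : traceDist ρ σ ≤ 0) : ρ = σ := by
  obtain ⟨P, Q, hP, hQ, hPQ, ht⟩ := exists_sub_eq_traceDist hρ hσ
  have p := trace_re_nonneg hP
  have q := trace_re_nonneg hQ
  have hz : ∀ {M : Matrix n n ℂ}, M.PosSemidef → M.trace.re = 0 → M = 0 := fun hM h0 =>
    hM.trace_eq_zero_iff.mp (Complex.ext h0 (Complex.le_def.mp hM.trace_nonneg).2.symm)
  rw [hz hP (by linarith), hz hQ (by linarith), sub_zero] at hPQ
  exact sub_eq_zero.mp hPQ

theorem traceDist_self (ρ : Matrix n n ℂ) : traceDist ρ ρ = 0 := by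
  simp [traceDist]

/-- A test distinguishes two states by at most their trace distance. -/
theorem trace_mul_re_sub_le_traceDist {ρ σ Λ : Matrix n n ℂ} (hρ : IsState ρ) (hσ : IsState σ)
    (h0 : 0 ≤ Λ) (h1 : Λ ≤ 1) :
    (Λ * ρ).trace.re - (Λ * σ).trace.re ≤ traceDist ρ σ := by
  obtain ⟨P, Q, hP, hQ, hPQ, ht⟩ := exists_sub_eq_traceDist hρ.1.1 hσ.1.1
  have htr : P.trace.re = Q.trace.re := by
    have := congrArg (fun M => M.trace.re) hPQ
    simp only [trace_sub, hρ.2, hσ.2, Complex.sub_re] at this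
    linarith
  have e1 := trace_mul_re_le h1 hP
  have e2 := trace_mul_re_nonneg h0.posSemidef hQ
  rw [one_mul] at e1
  rw [ht, ← Complex.sub_re, ← trace_sub, ← mul_sub, hPQ, mul_sub, trace_sub, Complex.sub_re]
  linarith

open scoped Matrix.Norms.L2Operator in
theorem opNorm_le_iff {M : Matrix n n ℂ} (hM : M.PosSemidef) {r : ℝ} (hr : 0 ≤ r) :
    opNorm M ≤ r ↔ M ≤ r • 1 := by
  have h := CStarAlgebra.norm_le_iff_le_algebraMap M hr hM.nonneg
  rw [Algebra.algebraMap_eq_smul_one] at h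
  exact h

/-! ### Support projector and square roots -/

theorem supportProj_posSemidef (ρ : Matrix n n ℂ) : (supportProj ρ).PosSemidef :=
  (cfc_nonneg fun t _ => by split_ifs <;> norm_num : 0 ≤ supportProj ρ).posSemidef

theorem supportProj_le_one (ρ : Matrix n n ℂ) : supportProj ρ ≤ 1 :=
  cfc_le_one _ _ fun t _ => by split_ifs <;> norm_num

theorem supportProj_mul_self {ρ : Matrix n n ℂ} (hρ : ρ.IsHermitian) :
    supportProj ρ * ρ = ρ := by
  have hs : IsSelfAdjoint ρ := hρ
  have hc := continuousOn_spectrum ρ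
  conv_rhs => rw [← cfc_id' ℝ ρ]
  conv_lhs => arg 2; rw [← cfc_id' ℝ ρ]
  rw [supportProj, ← cfc_mul _ _ _ (hc _) (hc _)]
  refine cfc_congr fun t _ => ?_
  by_cases h : t = 0 <;> simp [h]

theorem supportProj_eq_mul {ρ : Matrix n n ℂ} (hρ : ρ.IsHermitian) :
    supportProj ρ = cfc (fun t : ℝ => t⁻¹) ρ * ρ := by
  have hs : IsSelfAdjoint ρ := hρ
  have hc := continuousOn_spectrum ρ
  conv_rhs => arg 2; rw [← cfc_id' ℝ ρ]
  rw [supportProj, ← cfc_mul _ _ _ (hc _) (hc _)]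
  refine cfc_congr fun t _ => ?_
  by_cases h : t = 0 <;> simp [h]

theorem supportProj_mul_supportProj (ρ : Matrix n n ℂ) :
    supportProj ρ * supportProj ρ = supportProj ρ := by
  have hc := continuousOn_spectrum ρ
  rw [supportProj, ← cfc_mul _ _ _ (hc _) (hc _)]
  refine cfc_congr fun t _ => ?_
  by_cases h : t = 0 <;> simp [h]

/-- The support projector of `σ` fixes every `ρ` whose support lies in that of `σ`. -/
theorem mul_supportProj_of_ker_le {ρ σ : Matrix n n ℂ} (hσ : σ.IsHermitian)
    (h : ∀ v : n → ℂ, σ.mulVec v = 0 → ρ.mulVec v = 0) : ρ * supportProj σ = ρ := by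
  have h1 : σ * (1 - supportProj σ) = 0 := by
    rw [mul_sub, mul_one, sub_eq_zero]
    have := congrArg conjTranspose (supportProj_mul_self hσ)
    rw [conjTranspose_mul, hσ.eq, (supportProj_posSemidef σ).1.eq] at this
    exact this.symm
  have h2 : ρ * (1 - supportProj σ) = 0 := by
    ext i j
    have := h ((1 - supportProj σ).col j) (by
      ext k; simpa [mul_apply, mulVec, dotProduct] using congrFun (congrFun h1 k) j)
    simpa [mul_apply, mulVec, dotProduct] using congrFun this i
  rw [mul_sub, mul_one, sub_eq_zero] at h2
  exact h2.symm

/-- The square root of a positive semidefinite matrix, by functional calculus. -/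
def psdSqrt (σ : Matrix n n ℂ) : Matrix n n ℂ := cfc Real.sqrt σ

theorem psdSqrt_isHermitian (σ : Matrix n n ℂ) : (psdSqrt σ).IsHermitian :=
  (cfc_predicate _ σ : IsSelfAdjoint _)

theorem invSqrt_isHermitian (σ : Matrix n n ℂ) : (invSqrt σ).IsHermitian :=
  (cfc_predicate _ σ : IsSelfAdjoint _)

theorem nonneg_of_mem_spectrum {σ : Matrix n n ℂ} (hσ : σ.PosSemidef) {t : ℝ} (ht : t ∈ spectrum ℝ σ) :
    0 ≤ t := spectrum_nonneg_of_nonneg hσ.nonneg ht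

theorem psdSqrt_mul_psdSqrt {σ : Matrix n n ℂ} (hσ : σ.PosSemidef) :
    psdSqrt σ * psdSqrt σ = σ := by
  have hs : IsSelfAdjoint σ := hσ.1
  have hc := continuousOn_spectrum σ
  conv_rhs => rw [← cfc_id' ℝ σ]
  rw [psdSqrt, ← cfc_mul _ _ _ (hc _) (hc _)]
  exact cfc_congr fun t ht => Real.mul_self_sqrt (nonneg_of_mem_spectrum hσ ht)

theorem mul_eq_zero_of_conj_eq_zero {ρ K : Matrix n n ℂ} (hρ : ρ.PosSemidef)
    (h : K * ρ * Kᴴ = 0) : K * ρ = 0 := by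
  have e : K * psdSqrt ρ * (K * psdSqrt ρ)ᴴ = 0 := by
    rw [conjTranspose_mul, (psdSqrt_isHermitian ρ).eq, ← mul_assoc, mul_assoc K,
      psdSqrt_mul_psdSqrt hρ, h]
  rw [← psdSqrt_mul_psdSqrt hρ, ← mul_assoc, self_mul_conjTranspose_eq_zero.mp e, zero_mul]

theorem psdSqrt_mul_invSqrt {σ : Matrix n n ℂ} (hσ : σ.PosSemidef) :
    psdSqrt σ * invSqrt σ = supportProj σ := by
  have hc := continuousOn_spectrum σ
  rw [psdSqrt, invSqrt, supportProj, ← cfc_mul _ _ _ (hc _) (hc _)]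
  refine cfc_congr fun t ht => ?_
  by_cases h : t = 0
  · simp [h]
  · simp [h, Real.sqrt_ne_zero', lt_of_le_of_ne (nonneg_of_mem_spectrum hσ ht) (Ne.symm h)]

theorem invSqrt_mul_psdSqrt {σ : Matrix n n ℂ} (hσ : σ.PosSemidef) :
    invSqrt σ * psdSqrt σ = supportProj σ := by
  have := congrArg conjTranspose (psdSqrt_mul_invSqrt hσ)
  rwa [conjTranspose_mul, (psdSqrt_isHermitian σ).eq, (invSqrt_isHermitian σ).eq,
    (supportProj_posSemidef σ).1.eq] at this

theorem invSqrt_mul_mul_invSqrt {σ : Matrix n n ℂ} (hσ : σ.PosSemidef) :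
    invSqrt σ * σ * invSqrt σ = supportProj σ := by
  conv_lhs => arg 1; arg 2; rw [← psdSqrt_mul_psdSqrt hσ]
  rw [← mul_assoc, mul_assoc, psdSqrt_mul_invSqrt hσ, invSqrt_mul_psdSqrt hσ,
    supportProj_mul_supportProj]

end MatrixAnalysis

/-! ### The max-relative entropy as an operator inequality -/

theorem conj_le_conj {n : Type u} {m : Type v} [Fintype n] [Fintype m] {M N : Matrix n n ℂ}
    (h : M ≤ N) (K : Matrix m n ℂ) : K * M * Kᴴ ≤ K * N * Kᴴ := by
  have := (Matrix.le_iff.mp h).mul_mul_conjTranspose_same K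
  rw [Matrix.le_iff]
  rwa [Matrix.mul_sub, Matrix.sub_mul] at this

theorem smul_le_smul_psd {n : Type u} [Fintype n] {M N : Matrix n n ℂ}
    (h : M ≤ N) {r : ℝ} (hr : 0 ≤ r) : r • M ≤ r • N := by
  rw [Matrix.le_iff, ← smul_sub]
  exact (Matrix.le_iff.mp h).smul hr

theorem elog2_le_coe_iff {t c : ℝ} : elog2 t ≤ (c : EReal) ↔ t ≤ (2 : ℝ) ^ c := by
  unfold elog2
  split_ifs with h
  · simp [h.trans (Real.rpow_pos_of_pos two_pos c).le]
  · rw [EReal.coe_le_coe_iff, Real.logb_le_iff_le_rpow one_lt_two (not_le.mp h)]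

/-- Both sides fail when the support of `ρ` is not contained in that of `σ`. -/
theorem Dmax_le_coe_iff {n : Type u} [Fintype n] [DecidableEq n] {ρ σ : Matrix n n ℂ}
    (hρ : ρ.PosSemidef) (hσ : σ.PosSemidef) {c : ℝ} :
    Dmax ρ σ ≤ (c : EReal) ↔ ρ ≤ ((2 : ℝ) ^ c) • σ := by
  have hc : (0 : ℝ) < 2 ^ c := Real.rpow_pos_of_pos two_pos c
  have hSh := invSqrt_isHermitian σ
  have hRh := psdSqrt_isHermitian σ
  unfold Dmax
  split_ifs with hker
  · have hpsd : (invSqrt σ * ρ * invSqrt σ).PosSemidef := by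
      simpa [hSh.eq] using hρ.mul_mul_conjTranspose_same (invSqrt σ)
    rw [elog2_le_coe_iff, opNorm_le_iff hpsd hc.le]
    constructor
    · intro h
      have h2 := conj_le_conj h (psdSqrt σ)
      have e1 : ρ * supportProj σ = ρ := mul_supportProj_of_ker_le hσ.1 hker
      have e2 : supportProj σ * ρ = ρ := by
        have := congrArg conjTranspose e1
        rwa [conjTranspose_mul, hρ.1.eq, (supportProj_posSemidef σ).1.eq] at this
      have e3 : psdSqrt σ * (invSqrt σ * ρ * invSqrt σ) * psdSqrt σ = ρ := by
        rw [← mul_assoc, ← mul_assoc, psdSqrt_mul_invSqrt hσ, mul_assoc, invSqrt_mul_psdSqrt hσ,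
          e2, e1]
      rwa [hRh.eq, e3, mul_smul_comm, smul_mul_assoc, mul_one, psdSqrt_mul_psdSqrt hσ] at h2
    · intro h
      have h2 := conj_le_conj h (invSqrt σ)
      rw [hSh.eq, mul_smul_comm, smul_mul_assoc, invSqrt_mul_mul_invSqrt hσ] at h2
      exact h2.trans (smul_le_smul_psd (supportProj_le_one σ) hc.le)
  · refine iff_of_false (by simp) fun h => hker fun v hv => ?_
    have h1 := (Matrix.le_iff.mp h).dotProduct_mulVec_nonneg v
    rw [sub_mulVec, smul_mulVec, hv, smul_zero, zero_sub, dotProduct_neg] at h1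
    exact (hρ.dotProduct_mulVec_zero_iff v).mp
      (le_antisymm (neg_nonneg.mp h1) (hρ.dotProduct_mulVec_nonneg v))

/-! ### Partial traces -/

section PartialTrace
variable {A : Type u} {B : Type v} [Fintype A]

theorem trFst_posSemidef {M : Matrix (A × B) (A × B) ℂ} (hM : M.PosSemidef) :
    (trFst M).PosSemidef := by
  have : trFst M = ∑ a, M.submatrix (fun b => (a, b)) (fun b => (a, b)) := by
    ext b b'
    simp [trFst, Matrix.sum_apply]
  rw [this]
  exact posSemidef_sum _ fun a _ => hM.submatrix _

theorem trace_trFst [Fintype B] (M : Matrix (A × B) (A × B) ℂ) : (trFst M).trace = M.trace := by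
  simp only [trace, diag, trFst, of_apply, Fintype.sum_prod_type]
  exact Finset.sum_comm

theorem trFst_add (M N : Matrix (A × B) (A × B) ℂ) :
    trFst (M + N) = trFst M + trFst N := by
  ext i j
  simp [trFst, Finset.sum_add_distrib]

theorem trFst_sub (M N : Matrix (A × B) (A × B) ℂ) :
    trFst (M - N) = trFst M - trFst N := by
  ext i j
  simp [trFst, Finset.sum_sub_distrib]

theorem trFst_smul (r : ℝ) (M : Matrix (A × B) (A × B) ℂ) :
    trFst (r • M) = r • trFst M := by
  ext i j
  simp [trFst, Finset.mul_sum]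

theorem IsState.trFst [Fintype B] {ρ : Matrix (A × B) (A × B) ℂ} (hρ : IsState ρ) :
    IsState (trFst ρ) :=
  ⟨trFst_posSemidef hρ.1, by rw [trace_trFst, hρ.2]⟩

theorem trace_mul_one_kronecker [DecidableEq A] [Fintype B] (M : Matrix (A × B) (A × B) ℂ)
    (σ : Matrix B B ℂ) : (M * ((1 : Matrix A A ℂ) ⊗ₖ σ)).trace = (trFst M * σ).trace := by
  simp only [trace, diag, mul_apply, trFst, of_apply, Fintype.sum_prod_type, kroneckerMap_apply,
    one_apply, ite_mul, one_mul, zero_mul, mul_ite, mul_zero, Finset.sum_ite_irrel,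
    Finset.sum_const_zero, Finset.sum_ite_eq', Finset.mem_univ, if_true, Finset.sum_mul]
  rw [Finset.sum_comm]
  exact Finset.sum_congr rfl fun _ _ => Finset.sum_comm

theorem uniform_kronecker [DecidableEq A] (σ : Matrix B B ℂ) :
    uniform A ⊗ₖ σ = (Fintype.card A : ℝ)⁻¹ • ((1 : Matrix A A ℂ) ⊗ₖ σ) := by
  ext p q
  simp [uniform, mul_assoc]

theorem uniform_isState [DecidableEq A] [Nonempty A] : IsState (uniform A) := by
  refine ⟨PosSemidef.one.smul (by positivity), ?_⟩
  simp [uniform, trace_smul]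

end PartialTrace

theorem IsState.nonempty {n : Type u} [Fintype n] {ρ : Matrix n n ℂ} (hρ : IsState ρ) :
    Nonempty n := by
  by_contra h
  rw [not_nonempty_iff] at h
  have := hρ.2
  simp [trace] at this

theorem one_kronecker_posSemidef {A : Type u} {B : Type v} [Fintype A] [DecidableEq A] [Fintype B]
    [DecidableEq B] {σ : Matrix B B ℂ} (hσ : σ.PosSemidef) :
    ((1 : Matrix A A ℂ) ⊗ₖ σ).PosSemidef := PosSemidef.one.kronecker hσ

/-! ### The conditional min-entropy as an operator inequality -/

section MinEntropy
variable {A : Type u} {B : Type v} [Fintype A] [DecidableEq A] [Fintype B] [DecidableEq B]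

theorem elog2_natCast {n : ℕ} (hn : 0 < n) : elog2 n = ((Real.logb 2 n : ℝ) : EReal) := by
  have : (0 : ℝ) < n := by exact_mod_cast hn
  simp [elog2, not_le.mpr this]

theorem coe_le_HminDown_iff {τ : Matrix (A × B) (A × B) ℂ} (hτ : IsState τ) {c : ℝ} :
    (c : EReal) ≤ HminDown τ ↔ τ ≤ ((2 : ℝ) ^ (-c)) • ((1 : Matrix A A ℂ) ⊗ₖ trFst τ) := by
  have hA : 0 < Fintype.card A := Fintype.card_pos_iff.mpr (hτ.nonempty.map Prod.fst)
  have hA' : (0 : ℝ) < Fintype.card A := by exact_mod_cast hA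
  have hσ : (uniform A ⊗ₖ trFst τ).PosSemidef := by
    rw [uniform_kronecker]
    exact (one_kronecker_posSemidef (trFst_posSemidef hτ.1)).smul (by positivity : (0:ℝ) ≤ _)
  have key := Dmax_le_coe_iff hτ.1 hσ (c := Real.logb 2 (Fintype.card A) - c)
  have e : ((2 : ℝ) ^ (Real.logb 2 (Fintype.card A) - c)) • (uniform A ⊗ₖ trFst τ) =
      ((2 : ℝ) ^ (-c)) • ((1 : Matrix A A ℂ) ⊗ₖ trFst τ) := by
    rw [uniform_kronecker, smul_smul, sub_eq_add_neg, Real.rpow_add two_pos,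
      Real.rpow_logb two_pos (by norm_num) hA']
    congr 1
    field_simp
  rw [e] at key
  rw [← key, HminDown, elog2_natCast hA]
  induction Dmax τ (uniform A ⊗ₖ trFst τ) with
  | bot => simp
  | top => simp [-EReal.coe_sub]
  | coe d => norm_cast; constructor <;> intro h <;> linarith

end MinEntropy

theorem ereal_eq_of_forall_coe_le_iff {x y : EReal}
    (h : ∀ c : ℝ, (c : EReal) ≤ x ↔ (c : EReal) ≤ y) :
    x = y := by
  refine le_antisymm (EReal.le_of_forall_lt_iff_le.mp fun z hz => ?_)
    (EReal.le_of_forall_lt_iff_le.mp fun z hz => ?_)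
  · by_contra hc
    obtain ⟨d, hd⟩ := EReal.lt_iff_exists_real_btwn.mp (not_le.mp hc)
    exact absurd ((h d).mp hd.2.le) (not_le.mpr (hz.trans hd.1))
  · by_contra hc
    obtain ⟨d, hd⟩ := EReal.lt_iff_exists_real_btwn.mp (not_le.mp hc)
    exact absurd ((h d).mpr hd.2.le) (not_le.mpr (hz.trans hd.1))

/-! ### Isometric embeddings -/

section Embed
variable {A : Type u} {B : Type v} [Fintype A] [DecidableEq A] [Fintype B] [DecidableEq B]
  {A' : Type w} [Fintype A'] [DecidableEq A']

/-- The isometry `|a⟩ ↦ |f a⟩`. -/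
def embedMat (f : A ↪ A') : Matrix A' A ℂ := Matrix.of fun i a => if i = f a then 1 else 0

omit [DecidableEq A] [Fintype A'] in
theorem embed_eq (f : A ↪ A') (ρ : Matrix (A × B) (A × B) ℂ) :
    embed f ρ = (embedMat f ⊗ₖ (1 : Matrix B B ℂ)) * ρ * (embedMat f ⊗ₖ (1 : Matrix B B ℂ))ᴴ := rfl

omit [Fintype A] in
theorem embedMat_conjTranspose_mul (f : A ↪ A') : (embedMat f)ᴴ * embedMat f = 1 := by
  ext a a'
  simp [embedMat, mul_apply, one_apply, eq_comm]

omit [Fintype A] in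
theorem isometry_kronecker (f : A ↪ A') :
    (embedMat f ⊗ₖ (1 : Matrix B B ℂ))ᴴ * (embedMat f ⊗ₖ (1 : Matrix B B ℂ)) = 1 := by
  rw [conjTranspose_kronecker, ← mul_kronecker_mul, embedMat_conjTranspose_mul, conjTranspose_one,
    mul_one, one_kronecker_one]

theorem embed_trace (f : A ↪ A') (ρ : Matrix (A × B) (A × B) ℂ) :
    (embed f ρ).trace = ρ.trace := by
  rw [embed_eq, trace_mul_comm, ← Matrix.mul_assoc, isometry_kronecker, Matrix.one_mul]

omit [DecidableEq A] in
theorem embed_posSemidef (f : A ↪ A') {ρ : Matrix (A × B) (A × B) ℂ} (hρ : ρ.PosSemidef) :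
    (embed f ρ).PosSemidef := hρ.mul_mul_conjTranspose_same _

theorem embed_isState (f : A ↪ A') {ρ : Matrix (A × B) (A × B) ℂ} (hρ : IsState ρ) :
    IsState (embed f ρ) := ⟨embed_posSemidef f hρ.1, by rw [embed_trace, hρ.2]⟩

omit [DecidableEq A] [Fintype A'] in
theorem embed_apply (f : A ↪ A') (ρ : Matrix (A × B) (A × B) ℂ) (p q : A' × B) :
    embed f ρ p q = ∑ a, ∑ a', if p.1 = f a ∧ q.1 = f a' then ρ (a, p.2) (a', q.2) else 0 := by
  have : ∀ (p : A' × B) (a : A) (b : B), (embedMat f ⊗ₖ (1 : Matrix B B ℂ)) p (a, b) =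
      if b = p.2 then (if p.1 = f a then 1 else 0) else 0 := by
    intro p a b
    simp [embedMat, one_apply, eq_comm]
  have hr : (∑ a, ∑ a', if p.1 = f a ∧ q.1 = f a' then ρ (a, p.2) (a', q.2) else 0) =
      ∑ a', ∑ a, if q.1 = f a' then (if p.1 = f a then ρ (a, p.2) (a', q.2) else 0) else 0 := by
    rw [Finset.sum_comm]
    refine Finset.sum_congr rfl fun a' _ => Finset.sum_congr rfl fun a _ => ?_
    split_ifs <;> simp_all
  rw [embed_eq, hr]
  simp only [mul_apply, conjTranspose_apply, Fintype.sum_prod_type, this, Finset.sum_mul]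
  simp [apply_ite]

omit [DecidableEq A] in
theorem trFst_embed (f : A ↪ A') (ρ : Matrix (A × B) (A × B) ℂ) :
    trFst (embed f ρ) = trFst ρ := by
  ext b b'
  simp only [trFst, of_apply, embed_apply]
  rw [Finset.sum_comm]
  refine Finset.sum_congr rfl fun a _ => ?_
  rw [Finset.sum_comm, Finset.sum_eq_single a]
  · simp
  · intro a' _ h
    refine Finset.sum_eq_zero fun x _ => if_neg ?_
    rintro ⟨rfl, h'⟩
    exact h (f.injective h').symm
  · simp

omit [DecidableEq A] in
theorem embed_embed {A'' : Type x} [Fintype A''] [DecidableEq A''] (f : A ↪ A') (g : A' ↪ A'')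
    (ρ : Matrix (A × B) (A × B) ℂ) : embed g (embed f ρ) = embed (f.trans g) ρ := by
  have h : embedMat (f.trans g) = embedMat g * embedMat f := by
    ext i a
    simp [embedMat, mul_apply]
  have h' : embedMat (f.trans g) ⊗ₖ (1 : Matrix B B ℂ) =
      (embedMat g ⊗ₖ (1 : Matrix B B ℂ)) * (embedMat f ⊗ₖ (1 : Matrix B B ℂ)) := by
    rw [← mul_kronecker_mul, h, mul_one]
  rw [embed_eq, embed_eq, embed_eq, h', conjTranspose_mul]
  simp only [Matrix.mul_assoc]

/-- The embedding `|a⟩ ↦ |0⟩ ⊗ |a⟩` that adjoins a battery of dimension `m`. -/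
def batteryEmbedding (A : Type u) (m : ℕ) [NeZero m] : A ↪ Fin m × A :=
  ⟨fun a => (0, a), fun _ _ h => (Prod.ext_iff.mp h).2⟩

omit [Fintype A] [DecidableEq A] in
theorem batteryEmbedding_apply (m : ℕ) [NeZero m] (a : A) : batteryEmbedding A m a = (0, a) := rfl

theorem withBattery_eq_embed (m : ℕ) [NeZero m] (ρ : Matrix (A × B) (A × B) ℂ) :
    withBattery m ρ = embed (batteryEmbedding A m) ρ := by
  ext ⟨⟨i, a⟩, b⟩ ⟨⟨i', a'⟩, b'⟩
  rw [embed_apply]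
  simp only [withBattery, reindex_apply, submatrix_apply, Equiv.symm_symm, Equiv.prodAssoc_apply,
    kroneckerMap_apply, ket, single_apply, batteryEmbedding_apply, Prod.mk.injEq]
  by_cases hi : i = 0 <;> by_cases hi' : i' = 0 <;>
    simp [hi, hi', ite_and, eq_comm, Finset.sum_ite_irrel]

theorem embed_one_kronecker_le (f : A ↪ A') {σ : Matrix B B ℂ} (hσ : σ.PosSemidef) :
    embed f ((1 : Matrix A A ℂ) ⊗ₖ σ) ≤ (1 : Matrix A' A' ℂ) ⊗ₖ σ := by
  rw [embed_eq, conjTranspose_kronecker, ← mul_kronecker_mul, ← mul_kronecker_mul, Matrix.mul_one,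
    conjTranspose_one, Matrix.one_mul, Matrix.mul_one]
  -- `V V†` is an orthogonal projection
  have hproj : embedMat f * (embedMat f)ᴴ ≤ 1 := by
    have hp : (1 - embedMat f * (embedMat f)ᴴ) * (1 - embedMat f * (embedMat f)ᴴ)ᴴ =
        1 - embedMat f * (embedMat f)ᴴ := by
      have : embedMat f * (embedMat f)ᴴ * (embedMat f * (embedMat f)ᴴ) =
          embedMat f * (embedMat f)ᴴ := by
        rw [Matrix.mul_assoc, ← Matrix.mul_assoc _ (embedMat f), embedMat_conjTranspose_mul,
          Matrix.one_mul]
      rw [conjTranspose_sub, conjTranspose_one, conjTranspose_mul, conjTranspose_conjTranspose,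
        mul_sub, sub_mul, sub_mul, this]
      simp
    rw [Matrix.le_iff, ← hp]
    exact posSemidef_self_mul_conjTranspose _
  rw [Matrix.le_iff] at hproj ⊢
  have := hproj.kronecker hσ
  convert this using 1
  ext p q
  simp [sub_mul]

/-- The min-entropy is insensitive to isometric embeddings of Alice's system: with `V` the
isometry, `V† (𝟙 ⊗ τ_B) V = 𝟙 ⊗ τ_B` and `V (𝟙 ⊗ τ_B) V† ≤ 𝟙 ⊗ τ_B`. -/
theorem HminDown_embed (f : A ↪ A') {τ : Matrix (A × B) (A × B) ℂ} (hτ : IsState τ) :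
    HminDown (embed f τ) = HminDown τ := by
  refine ereal_eq_of_forall_coe_le_iff fun c => ?_
  rw [coe_le_HminDown_iff (embed_isState f hτ), coe_le_HminDown_iff hτ, trFst_embed]
  have hc : (0 : ℝ) ≤ 2 ^ (-c) := by positivity
  constructor
  · intro h
    have h1 := conj_le_conj h (embedMat f ⊗ₖ (1 : Matrix B B ℂ))ᴴ
    rw [conjTranspose_conjTranspose, embed_eq, Matrix.mul_smul, Matrix.smul_mul] at h1
    have e1 : ∀ X : Matrix (A × B) (A × B) ℂ, (embedMat f ⊗ₖ (1 : Matrix B B ℂ))ᴴ *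
        ((embedMat f ⊗ₖ (1 : Matrix B B ℂ)) * X * (embedMat f ⊗ₖ (1 : Matrix B B ℂ))ᴴ) *
        (embedMat f ⊗ₖ (1 : Matrix B B ℂ)) = X := by
      intro X
      simp only [Matrix.mul_assoc, isometry_kronecker, Matrix.mul_one]
      rw [← Matrix.mul_assoc, isometry_kronecker, Matrix.one_mul]
    rwa [e1, conjTranspose_kronecker, ← mul_kronecker_mul, ← mul_kronecker_mul, Matrix.mul_one,
      embedMat_conjTranspose_mul, conjTranspose_one, Matrix.one_mul, Matrix.mul_one] at h1
  · intro h
    have h1 := conj_le_conj h (embedMat f ⊗ₖ (1 : Matrix B B ℂ))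
    rw [← embed_eq, Matrix.mul_smul, Matrix.smul_mul] at h1
    exact h1.trans (smul_le_smul_psd (embed_one_kronecker_le f (trFst_posSemidef hτ.1)) hc)

theorem traceDist_embed_le (f : A ↪ A') {ρ σ : Matrix (A × B) (A × B) ℂ} (hρ : ρ.IsHermitian)
    (hσ : σ.IsHermitian) : traceDist (embed f ρ) (embed f σ) ≤ traceDist ρ σ := by
  obtain ⟨P, Q, hP, hQ, hPQ, ht⟩ := exists_sub_eq_traceDist hρ hσ
  rw [ht, ← embed_trace f P, ← embed_trace f Q]
  refine traceDist_le_of_sub_eq (embed_posSemidef f hP) (embed_posSemidef f hQ) ?_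
  simp only [embed_eq]
  rw [← Matrix.sub_mul, ← Matrix.mul_sub, hPQ, Matrix.mul_sub, Matrix.sub_mul]

end Embed

/-! ### Tests and the conditional max-entropy -/

section Minimax
variable {n : Type u} [Fintype n] [DecidableEq n]

theorem IsState.le_one {σ : Matrix n n ℂ} (hσ : IsState σ) : σ ≤ 1 := by
  have hs : IsSelfAdjoint σ := hσ.1.1
  rw [← map_one (algebraMap ℝ (Matrix n n ℂ)), le_algebraMap_iff_spectrum_le (p := IsSelfAdjoint)]
  intro t ht
  rw [hσ.1.1.spectrum_real_eq_range_eigenvalues] at ht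
  obtain ⟨i, rfl⟩ := ht
  have h1 : ∑ i, hσ.1.1.eigenvalues i = 1 := by
    have := hσ.1.1.trace_eq_sum_eigenvalues.symm.trans hσ.2
    rw [← RCLike.ofReal_sum] at this
    exact RCLike.ofReal_injective (this.trans RCLike.ofReal_one.symm)
  rw [← h1]
  exact Finset.single_le_sum (fun j _ => hσ.1.eigenvalues_nonneg j) (Finset.mem_univ i)

open scoped Matrix.Norms.L2Operator in
theorem isCompact_Icc_zero_one : IsCompact (Set.Icc (0 : Matrix n n ℂ) 1) := by
  have : ProperSpace (Matrix n n ℂ) := FiniteDimensional.proper ℂ _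
  refine (isCompact_closedBall (0 : Matrix n n ℂ) 1).of_isClosed_subset isClosed_Icc ?_
  rintro M ⟨h0, h1⟩
  rw [mem_closedBall_zero_iff]
  exact (CStarAlgebra.norm_le_one_iff_of_nonneg M h0).mpr h1

/-- The tests `0 ≤ Λ ≤ 𝟙` that accept `ρ` with probability at least `1 - ε`. -/
def tests (ε : ℝ) (ρ : Matrix n n ℂ) : Set (Matrix n n ℂ) :=
  {Λ | 0 ≤ Λ ∧ Λ ≤ 1 ∧ 1 - ε ≤ (Λ * ρ).trace.re}

omit [DecidableEq n] in
theorem continuous_trace_mul_re (ρ : Matrix n n ℂ) :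
    Continuous fun Λ : Matrix n n ℂ => (Λ * ρ).trace.re := by fun_prop

theorem isCompact_tests (ε : ℝ) (ρ : Matrix n n ℂ) : IsCompact (tests ε ρ) := by
  have : tests ε ρ = Set.Icc 0 1 ∩ {Λ | 1 - ε ≤ (Λ * ρ).trace.re} := by
    ext Λ; simp [tests, and_assoc]
  rw [this]
  exact isCompact_Icc_zero_one.inter_right
    (isClosed_le continuous_const (continuous_trace_mul_re ρ))

theorem convex_Icc_zero_one : Convex ℝ (Set.Icc (0 : Matrix n n ℂ) 1) := by
  rintro M ⟨hM0, hM1⟩ N ⟨hN0, hN1⟩ a b ha hb hab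
  constructor
  · exact ((hM0.posSemidef.smul ha).add (hN0.posSemidef.smul hb)).nonneg
  · have := add_le_add (smul_le_smul_psd hM1 ha) (smul_le_smul_psd hN1 hb)
    rwa [← add_smul, hab, one_smul] at this

theorem convex_tests (ε : ℝ) (ρ : Matrix n n ℂ) : Convex ℝ (tests ε ρ) := by
  have : tests ε ρ = Set.Icc 0 1 ∩ {Λ | 1 - ε ≤ (Λ * ρ).trace.re} := by
    ext Λ; simp [tests, and_assoc]
  rw [this]
  refine convex_Icc_zero_one.inter fun M hM N hN a b ha hb hab => ?_
  simp only [Set.mem_ofPred_eq, add_mul, smul_mul, trace_add, trace_smul, Complex.add_re,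
    Complex.real_smul, Complex.re_ofReal_mul] at *
  have := add_le_add (mul_le_mul_of_nonneg_left hM ha) (mul_le_mul_of_nonneg_left hN hb)
  rwa [← add_mul, hab, one_mul] at this

theorem isCompact_states : IsCompact {σ : Matrix n n ℂ | IsState σ} := by
  have : {σ : Matrix n n ℂ | IsState σ} = Set.Icc 0 1 ∩ {σ | σ.trace = 1} := by
    ext σ
    exact ⟨fun h => ⟨⟨h.1.nonneg, h.le_one⟩, h.2⟩, fun h => ⟨h.1.1.posSemidef, h.2⟩⟩
  rw [this]
  exact isCompact_Icc_zero_one.inter_right (isClosed_eq (by fun_prop) continuous_const)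

omit [DecidableEq n] in
theorem convex_states : Convex ℝ {σ : Matrix n n ℂ | IsState σ} := by
  rintro M ⟨hM0, hM1⟩ N ⟨hN0, hN1⟩ a b ha hb hab
  refine ⟨(hM0.smul ha).add (hN0.smul hb), ?_⟩
  rw [trace_add, trace_smul, trace_smul, hM1, hN1, ← add_smul, hab, one_smul]

end Minimax

section MaxEntropy
variable {A : Type u} {B : Type v} [Fintype A] [DecidableEq A] [Fintype B] [DecidableEq B]

/-- The minimax step: if every side state `σ` admits a test whose weight on `𝟙 ⊗ σ` is at most
`c`, then a single test does for all of them. -/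
theorem exists_test_forall_state {ε c : ℝ} {ρ : Matrix (A × B) (A × B) ℂ} [Nonempty B]
    (h : ∀ σ : Matrix B B ℂ, IsState σ → ∃ Λ ∈ tests ε ρ,
      (Λ * ((1 : Matrix A A ℂ) ⊗ₖ σ)).trace.re ≤ c) :
    ∃ Λ ∈ tests ε ρ, ∀ σ : Matrix B B ℂ, IsState σ →
      (Λ * ((1 : Matrix A A ℂ) ⊗ₖ σ)).trace.re ≤ c := by
  have hB : {σ : Matrix B B ℂ | IsState σ}.Nonempty := ⟨_, uniform_isState⟩
  let f : Matrix (A × B) (A × B) ℂ →ₗ[ℝ] Matrix B B ℂ →ₗ[ℝ] ℝ :=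
    LinearMap.mk₂ ℝ (fun Λ σ => (Λ * ((1 : Matrix A A ℂ) ⊗ₖ σ)).trace.re)
      (by intros; simp [add_mul]) (by intros; simp)
      (by intros; simp [kronecker_add, mul_add]) (by intros; simp [kronecker_smul])
  obtain ⟨Λ₀, hΛ₀, -⟩ := h _ uniform_isState
  obtain ⟨Λ, hΛ, σ, hσ, hs⟩ := Sion.exists_isSaddlePointOn (f := fun Λ σ => f Λ σ)
    (X := tests ε ρ) (Y := {σ : Matrix B B ℂ | IsState σ})
    ⟨Λ₀, hΛ₀⟩ (convex_tests ε ρ) (isCompact_tests ε ρ)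
    (fun σ _ => (f.flip σ).continuous_of_finiteDimensional.continuousOn.lowerSemicontinuousOn)
    (fun σ _ => ((f.flip σ).convexOn (convex_tests ε ρ)).quasiconvexOn)
    convex_states hB isCompact_states
    (fun Λ _ => (f Λ).continuous_of_finiteDimensional.continuousOn.upperSemicontinuousOn)
    (fun Λ _ => ((f Λ).concaveOn convex_states).quasiconcaveOn)
  obtain ⟨Λ', hΛ', hc⟩ := h σ hσ
  exact ⟨Λ, hΛ, fun σ' hσ' => (hs Λ' hΛ' σ' hσ').trans hc⟩

omit [DecidableEq B] in
theorem trace_mul_uniform_kronecker (Λ : Matrix (A × B) (A × B) ℂ) (σ : Matrix B B ℂ) :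
    (Λ * (uniform A ⊗ₖ σ)).trace.re =
      (Λ * ((1 : Matrix A A ℂ) ⊗ₖ σ)).trace.re / Fintype.card A := by
  rw [uniform_kronecker, Matrix.mul_smul, trace_smul, Complex.real_smul, Complex.re_ofReal_mul,
    inv_mul_eq_div]

/-- A single test of weight at most `c` for all states of Bob bounds the max-entropy; no exchange
of quantifiers is needed in this direction. -/
theorem HmaxUpSmooth_le {ε c : ℝ} (hc : 0 < c) {ρ Λ : Matrix (A × B) (A × B) ℂ} [Nonempty A]
    (hΛ : Λ ∈ tests ε ρ) (h : ∀ σ : Matrix B B ℂ, IsState σ →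
      (Λ * ((1 : Matrix A A ℂ) ⊗ₖ σ)).trace.re ≤ c) :
    HmaxUpSmooth ε ρ ≤ (Real.logb 2 c : ℝ) := by
  have hA : 0 < Fintype.card A := Fintype.card_pos
  have hA' : (0 : ℝ) < Fintype.card A := by exact_mod_cast hA
  rw [HmaxUpSmooth, elog2_natCast hA]
  have key : ((Real.logb 2 (Fintype.card A) - Real.logb 2 c : ℝ) : EReal) ≤
      sInf {d : EReal | ∃ σ : Matrix B B ℂ, IsState σ ∧ d = DminSmooth ε ρ (uniform A ⊗ₖ σ)} := by
    refine le_sInf ?_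
    rintro _ ⟨σ, hσ, rfl⟩
    refine le_sSup_of_le ⟨Λ, hΛ.1, hΛ.2.1, hΛ.2.2, rfl⟩ ?_
    rw [EReal.le_neg, ← EReal.coe_neg, neg_sub, elog2_le_coe_iff, trace_mul_uniform_kronecker,
      Real.rpow_sub two_pos, Real.rpow_logb two_pos (by norm_num) hc,
      Real.rpow_logb two_pos (by norm_num) hA']
    exact div_le_div_of_nonneg_right (h σ hσ) hA'.le
  refine EReal.sub_le_of_le_add ?_
  calc ((Real.logb 2 (Fintype.card A) : ℝ) : EReal)
      = ((Real.logb 2 c : ℝ) : EReal)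
          + ((Real.logb 2 (Fintype.card A) - Real.logb 2 c : ℝ) : EReal) := by
        norm_cast; ring
    _ ≤ _ := by gcongr

theorem exists_test_of_HmaxUpSmooth_lt {ε c : ℝ} {ρ : Matrix (A × B) (A × B) ℂ} [Nonempty A]
    [Nonempty B] (h : HmaxUpSmooth ε ρ < (c : EReal)) :
    ∃ Λ ∈ tests ε ρ, ∀ σ : Matrix B B ℂ, IsState σ →
      (Λ * ((1 : Matrix A A ℂ) ⊗ₖ σ)).trace.re ≤ 2 ^ c := by
  have hA : 0 < Fintype.card A := Fintype.card_pos
  have hA' : (0 : ℝ) < Fintype.card A := by exact_mod_cast hA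
  refine exists_test_forall_state fun σ hσ => ?_
  have h1 : ((Real.logb 2 (Fintype.card A) - c : ℝ) : EReal) < DminSmooth ε ρ (uniform A ⊗ₖ σ) := by
    refine lt_of_lt_of_le ?_ (sInf_le ⟨σ, hσ, rfl⟩ : sInf {d : EReal | ∃ σ : Matrix B B ℂ,
      IsState σ ∧ d = DminSmooth ε ρ (uniform A ⊗ₖ σ)} ≤ _)
    rw [HmaxUpSmooth, elog2_natCast hA] at h
    revert h
    induction sInf {d : EReal | ∃ σ : Matrix B B ℂ,
      IsState σ ∧ d = DminSmooth ε ρ (uniform A ⊗ₖ σ)} with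
    | bot => simp
    | top => intro _; exact EReal.coe_lt_top _
    | coe d => norm_cast; intro h; linarith
  obtain ⟨_, ⟨Λ, h0, h1', h2, rfl⟩, hlt⟩ := lt_sSup_iff.mp h1
  refine ⟨Λ, ⟨h0, h1', h2⟩, ?_⟩
  have h3 := hlt.le
  rw [EReal.le_neg, ← EReal.coe_neg, neg_sub, elog2_le_coe_iff, trace_mul_uniform_kronecker,
      Real.rpow_sub two_pos, Real.rpow_logb two_pos (by norm_num) hA'] at h3
  exact (div_le_div_iff_of_pos_right hA').mp h3

/-- A test that accepts `ρ` with certainty dominates the support projector of `ρ`. -/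
theorem supportProj_le_of_one_le_trace {n : Type u} [Fintype n] [DecidableEq n]
    {ρ Λ : Matrix n n ℂ} (hρ : IsState ρ) (h1 : Λ ≤ 1) (h0 : 0 ≤ Λ)
    (h : 1 ≤ (Λ * ρ).trace.re) : supportProj ρ ≤ Λ := by
  have hK : (1 - Λ).PosSemidef := Matrix.le_iff.mp h1
  obtain ⟨C, hC⟩ := CStarAlgebra.nonneg_iff_eq_star_mul_self.mp hK.nonneg
  have hpsd : (C * ρ * Cᴴ).PosSemidef := hρ.1.mul_mul_conjTranspose_same C
  have htr : (C * ρ * Cᴴ).trace = ((1 - Λ) * ρ).trace := by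
    rw [hC, trace_mul_comm, ← mul_assoc]; rfl
  have hz : C * ρ * Cᴴ = 0 := by
    refine hpsd.trace_eq_zero_iff.mp (Complex.ext ?_ (Complex.le_def.mp hpsd.trace_nonneg).2.symm)
    refine le_antisymm ?_ (trace_re_nonneg hpsd)
    rw [htr, sub_mul, one_mul, trace_sub, hρ.2]
    simpa using h
  set P := supportProj ρ with hP
  have hPh : Pᴴ = P := (supportProj_posSemidef ρ).1
  have hPP : P * P = P := supportProj_mul_supportProj ρ
  have hCρ : C * ρ = 0 := mul_eq_zero_of_conj_eq_zero hρ.1 hz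
  have hKP : (1 - Λ) * P = 0 := by
    have e1 : (1 - Λ) * ρ = 0 := by
      rw [hC, mul_assoc, hCρ, mul_zero]
    have e2 : P = ρ * cfc (fun t : ℝ => t⁻¹) ρ := by
      have hcf : (cfc (fun t : ℝ => t⁻¹) ρ)ᴴ = cfc (fun t : ℝ => t⁻¹) ρ :=
        (cfc_predicate (fun t : ℝ => t⁻¹) ρ : IsSelfAdjoint _)
      rw [← hPh, hP, supportProj_eq_mul hρ.1.1, conjTranspose_mul, hρ.1.1.eq, hcf]
    rw [e2, ← mul_assoc, e1, zero_mul]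
  have hΛP : Λ * P = P := by
    rw [sub_mul, one_mul, sub_eq_zero] at hKP
    exact hKP.symm
  have hPΛ : P * Λ = P := by
    have := congrArg conjTranspose hΛP
    rwa [conjTranspose_mul, hPh, h0.posSemidef.1.eq] at this
  have e : (1 - P) * Λ * (1 - P)ᴴ = Λ - P := by
    rw [conjTranspose_sub, conjTranspose_one, hPh, sub_mul, one_mul, hPΛ, mul_sub, mul_one, sub_mul,
      hΛP, hPP]
    simp
  rw [Matrix.le_iff, ← e]
  exact h0.posSemidef.mul_mul_conjTranspose_same _

theorem elog2_mono {s t : ℝ} (h : s ≤ t) : elog2 s ≤ elog2 t := by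
  unfold elog2
  split_ifs with hs ht ht
  · exact le_rfl
  · exact bot_le
  · exact absurd (h.trans ht) hs
  · exact EReal.coe_le_coe_iff.mpr (Real.logb_le_logb_of_le one_lt_two (not_le.mp hs) h)

theorem DminSmooth_zero {n : Type u} [Fintype n] [DecidableEq n] {ρ σ : Matrix n n ℂ}
    (hρ : IsState ρ) (hσ : σ.PosSemidef) : DminSmooth 0 ρ σ = Dmin ρ σ := by
  refine le_antisymm (sSup_le ?_) (le_sSup ⟨supportProj ρ, (supportProj_posSemidef ρ).nonneg,
    supportProj_le_one ρ, ?_, rfl⟩)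
  · rintro _ ⟨Λ, h0, h1, h2, rfl⟩
    rw [sub_zero] at h2
    exact EReal.neg_le_neg_iff.mpr (elog2_mono
      (trace_mul_re_le (supportProj_le_of_one_le_trace hρ h1 h0 h2) hσ))
  · rw [supportProj_mul_self hρ.1.1, hρ.2]
    simp

theorem HmaxUpSmooth_zero {ρ : Matrix (A × B) (A × B) ℂ} (hρ : IsState ρ) :
    HmaxUpSmooth 0 ρ = HmaxUp ρ := by
  have hA : Nonempty A := hρ.nonempty.map Prod.fst
  rw [HmaxUpSmooth, HmaxUp]
  congr 2
  ext d
  refine exists_congr fun σ => and_congr_right fun hσ => ?_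
  rw [DminSmooth_zero hρ (uniform_isState.1.kronecker hσ.1)]

theorem HminDownSmooth_zero {ρ : Matrix (A × B) (A × B) ℂ} (hρ : IsState ρ) :
    HminDownSmooth 0 ρ = HminDown ρ := by
  refine le_antisymm (sSup_le ?_) (le_sSup ⟨Fintype.card A, (Fintype.equivFin A).toEmbedding,
    embed _ ρ, embed_isState _ hρ, (traceDist_self _).le, (HminDown_embed _ hρ).symm⟩)
  rintro _ ⟨m, f, τ, hτ, hd, rfl⟩
  rw [← eq_of_traceDist_le_zero (embed_isState f hρ).1.1 hτ.1.1 hd, HminDown_embed f hρ]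

end MaxEntropy

/-! ### Channels -/

section Channels
variable {a : Type u} {b : Type v} [Fintype a] [Fintype b]

theorem IsChannel.idTensor_posSemidef {Φ : Matrix a a ℂ →ₗ[ℂ] Matrix b b ℂ} (hΦ : IsChannel Φ)
    {R : Type w} [Finite R] {M : Matrix (R × a) (R × a) ℂ} (hM : M.PosSemidef) :
    (idTensor R Φ M).PosSemidef := by
  have := Fintype.ofFinite R
  let e := Fintype.equivFin R
  have h := hΦ.completelyPositive _ _ (hM.submatrix (Prod.map e.symm (id : a → a)))
  convert h.submatrix (Prod.map e (id : b → b)) using 1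
  ext p q
  simp [idTensor]

theorem IsChannel.tensorId_posSemidef {Φ : Matrix a a ℂ →ₗ[ℂ] Matrix b b ℂ} (hΦ : IsChannel Φ)
    {R : Type w} [Finite R] {M : Matrix (a × R) (a × R) ℂ} (hM : M.PosSemidef) :
    (tensorId R Φ M).PosSemidef :=
  (hΦ.idTensor_posSemidef (hM.submatrix Prod.swap)).submatrix Prod.swap

theorem trFst_tensorId {Φ : Matrix a a ℂ →ₗ[ℂ] Matrix b b ℂ} (hΦ : IsChannel Φ) {R : Type w}
    (M : Matrix (a × R) (a × R) ℂ) : trFst (tensorId R Φ M) = trFst M := by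
  ext r s
  exact hΦ.tracePreserving (Matrix.of fun y y' => M (y, r) (y', s))

theorem IsChannel.comp {c : Type w} [Fintype c] {Φ : Matrix a a ℂ →ₗ[ℂ] Matrix b b ℂ}
    {Ψ : Matrix b b ℂ →ₗ[ℂ] Matrix c c ℂ} (hΨ : IsChannel Ψ) (hΦ : IsChannel Φ) :
    IsChannel (Ψ ∘ₗ Φ) :=
  ⟨fun k M hM => hΨ.completelyPositive k _ (hΦ.completelyPositive k M hM),
    fun M => (hΨ.tracePreserving _).trans (hΦ.tracePreserving M)⟩

/-- Relabelling the basis. -/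
def relabel (e : a ≃ b) : Matrix a a ℂ →ₗ[ℂ] Matrix b b ℂ :=
  (reindexLinearEquiv ℂ ℂ e e).toLinearMap

omit [Fintype a] [Fintype b] in
theorem relabel_apply (e : a ≃ b) (M : Matrix a a ℂ) (i j : b) :
    relabel e M i j = M (e.symm i) (e.symm j) := rfl

theorem relabel_isChannel (e : a ≃ b) : IsChannel (relabel e) :=
  ⟨fun k _ hM => hM.submatrix fun p : Fin k × b => (p.1, e.symm p.2),
    fun M => e.symm.sum_comp fun i => M i i⟩

/-- The map with Choi matrix `J`. -/
def choiMap (J : Matrix (b × a) (b × a) ℂ) : Matrix a a ℂ →ₗ[ℂ] Matrix b b ℂ where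
  toFun X := Matrix.of fun p q => ∑ i, ∑ j, X i j * J (p, i) (q, j)
  map_add' X Y := by
    ext p q
    simp [add_mul, Finset.sum_add_distrib]
  map_smul' c X := by
    ext p q
    simp [mul_assoc, Finset.mul_sum]

omit [Fintype b] in
theorem choiMap_apply (J : Matrix (b × a) (b × a) ℂ) (X : Matrix a a ℂ) (p q : b) :
    choiMap J X p q = ∑ i, ∑ j, X i j * J (p, i) (q, j) := rfl

theorem choiMap_isChannel [DecidableEq a] {J : Matrix (b × a) (b × a) ℂ} (hJ : J.PosSemidef)
    (h1 : trFst J = 1) : IsChannel (choiMap J) := by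
  classical
  refine ⟨fun k M hM => ?_, fun X => ?_⟩
  · -- the output is a compression of a principal submatrix of `M ⊗ J`
    let Y := (M ⊗ₖ J).submatrix (fun x : (Fin k × b) × a => ((x.1.1, x.2), (x.1.2, x.2)))
      (fun x : (Fin k × b) × a => ((x.1.1, x.2), (x.1.2, x.2)))
    let V : Matrix (Fin k × b) ((Fin k × b) × a) ℂ := Matrix.of fun p x => if x.1 = p then 1 else 0
    have hY : Y.PosSemidef := (hM.kronecker hJ).submatrix _
    convert hY.mul_mul_conjTranspose_same V using 1
    ext p q
    simp [V, Y, mul_apply, idTensor, choiMap_apply, Fintype.sum_prod_type (α₁ := Fin k × b),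
      Finset.sum_ite_irrel, apply_ite]
    exact Finset.sum_comm
  · have : ∀ i j, ∑ p, J (p, i) (p, j) = (1 : Matrix a a ℂ) i j := fun i j => by rw [← h1]; rfl
    simp only [trace, diag, choiMap_apply]
    rw [Finset.sum_comm]
    refine Finset.sum_congr rfl fun i _ => ?_
    rw [Finset.sum_comm]
    simp only [← Finset.mul_sum, this]
    simp [one_apply]

omit [Fintype b] in
theorem choiMap_kronecker_transpose (S : Matrix b b ℂ) (K X : Matrix a a ℂ) :
    choiMap (S ⊗ₖ Kᵀ) X = (K * X).trace • S := by
  ext p q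
  simp only [choiMap_apply, kroneckerMap_apply, transpose_apply, Matrix.smul_apply, smul_eq_mul, trace,
    diag, mul_apply, Finset.sum_mul]
  rw [Finset.sum_comm]
  exact Finset.sum_congr rfl fun i _ => Finset.sum_congr rfl fun j _ => by ring

omit [Fintype b] in
theorem choiMap_add (J K : Matrix (b × a) (b × a) ℂ) (X : Matrix a a ℂ) :
    choiMap (J + K) X = choiMap J X + choiMap K X := by
  ext p q
  simp [choiMap_apply, mul_add, Finset.sum_add_distrib]

omit [Fintype b] in
theorem choiMap_sub (J K : Matrix (b × a) (b × a) ℂ) (X : Matrix a a ℂ) :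
    choiMap (J - K) X = choiMap J X - choiMap K X := by
  ext p q
  simp [choiMap_apply, mul_sub, Finset.sum_sub_distrib]

omit [Fintype b] in
theorem choiMap_smul (r : ℝ) (J : Matrix (b × a) (b × a) ℂ) (X : Matrix a a ℂ) :
    choiMap (r • J) X = r • choiMap J X := by
  ext p q
  simp [choiMap_apply, Finset.mul_sum, mul_left_comm]

omit [Fintype a] in
theorem trFst_kronecker (S : Matrix b b ℂ) (K : Matrix a a ℂ) : trFst (S ⊗ₖ K) = S.trace • K := by
  ext i j
  simp [trFst, trace, Finset.sum_mul]

/-- Measuring a two-outcome test `K` and preparing `S` on acceptance, `T` on rejection. -/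
def testAndPrepare [DecidableEq a] (K : Matrix a a ℂ) (S T : Matrix b b ℂ) :
    Matrix a a ℂ →ₗ[ℂ] Matrix b b ℂ :=
  choiMap (S ⊗ₖ Kᵀ + T ⊗ₖ (1 - K)ᵀ)

omit [Fintype b] in
theorem testAndPrepare_apply [DecidableEq a] (K : Matrix a a ℂ) (S T : Matrix b b ℂ)
    (X : Matrix a a ℂ) :
    testAndPrepare K S T X = (K * X).trace • S + (X.trace - (K * X).trace) • T := by
  rw [testAndPrepare, choiMap_add, choiMap_kronecker_transpose, choiMap_kronecker_transpose,
    sub_mul, one_mul, trace_sub]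

theorem testAndPrepare_isChannel [DecidableEq a] {K : Matrix a a ℂ} (h0 : 0 ≤ K) (h1 : K ≤ 1)
    {S T : Matrix b b ℂ} (hS : IsState S) (hT : IsState T) :
    IsChannel (testAndPrepare K S T) := by
  refine choiMap_isChannel ((hS.1.kronecker h0.posSemidef.transpose).add
    (hT.1.kronecker (Matrix.le_iff.mp h1).transpose)) ?_
  rw [trFst_add, trFst_kronecker, trFst_kronecker, hS.2, hT.2, one_smul, one_smul, ← transpose_add,
    add_sub_cancel, transpose_one]

/-- Preparing the state `S` whatever the input. -/
theorem prepare_isChannel [DecidableEq a] {S : Matrix b b ℂ} (hS : IsState S) :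
    IsChannel (choiMap (S ⊗ₖ (1 : Matrix a a ℂ)ᵀ)) := by
  refine choiMap_isChannel (hS.1.kronecker PosSemidef.one.transpose) ?_
  rw [trFst_kronecker, hS.2, one_smul, transpose_one]

/-- Measuring a register `P` in its basis and applying `Φ p` to the rest on outcome `p`; the
equivalence splits the input system into the register and the rest. -/
def controlled {P : Type w} [Fintype P] {c : Type x} (e : P × a ≃ c)
    (Φ : P → Matrix a a ℂ →ₗ[ℂ] Matrix b b ℂ) : Matrix c c ℂ →ₗ[ℂ] Matrix b b ℂ where
  toFun X := ∑ p, Φ p (X.submatrix (fun i => e (p, i)) (fun i => e (p, i)))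
  map_add' X Y := by
    rw [← Finset.sum_add_distrib]
    exact Finset.sum_congr rfl fun p _ => by rw [submatrix_add, ← map_add]; rfl
  map_smul' r X := by
    rw [Finset.smul_sum]
    exact Finset.sum_congr rfl fun p _ => by rw [submatrix_smul, RingHom.id_apply, ← map_smul]; rfl

omit [Fintype a] [Fintype b] in
theorem controlled_apply {P : Type w} [Fintype P] {c : Type x} (e : P × a ≃ c)
    (Φ : P → Matrix a a ℂ →ₗ[ℂ] Matrix b b ℂ) (X : Matrix c c ℂ) :
    controlled e Φ X = ∑ p, Φ p (X.submatrix (fun i => e (p, i)) (fun i => e (p, i))) := rfl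

theorem controlled_isChannel {P : Type w} [Fintype P] {c : Type x} [Fintype c] (e : P × a ≃ c)
    {Φ : P → Matrix a a ℂ →ₗ[ℂ] Matrix b b ℂ} (hΦ : ∀ p, IsChannel (Φ p)) :
    IsChannel (controlled e Φ) := by
  refine ⟨fun k M hM => ?_, fun X => ?_⟩
  · have : idTensor (Fin k) (controlled e Φ) M = ∑ p, idTensor (Fin k) (Φ p)
        (M.submatrix (Prod.map id fun i => e (p, i)) (Prod.map id fun i => e (p, i))) := by
      ext x y
      simp only [idTensor, of_apply, controlled_apply, Matrix.sum_apply]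
      rfl
    rw [this]
    exact posSemidef_sum _ fun p _ => (hΦ p).idTensor_posSemidef (hM.submatrix _)
  · rw [controlled_apply, trace_sum]
    simp only [(hΦ _).tracePreserving]
    simp only [trace, diag, submatrix_apply]
    rw [← e.sum_comp fun i => X i i, Fintype.sum_prod_type]

end Channels

/-! ### Effects -/

section Effects
variable {n : Type u} [Fintype n] [DecidableEq n]

theorem posSemidef_of_trace_mul_nonneg {Λ : Matrix n n ℂ}
    (h : ∀ X : Matrix n n ℂ, X.PosSemidef → 0 ≤ (Λ * X).trace) : Λ.PosSemidef := by
  rw [← Matrix.isPositive_toEuclideanLin_iff, LinearMap.isPositive_iff_complex]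
  intro x
  have h1 := h _ (posSemidef_vecMulVec_self_star x.ofLp)
  rw [mul_vecMulVec, trace_vecMulVec] at h1
  have e : inner ℂ (Matrix.toEuclideanLin Λ x) x = star ((Λ *ᵥ x.ofLp) ⬝ᵥ star x.ofLp) := by
    rw [EuclideanSpace.inner_eq_star_dotProduct, dotProduct_star]
    simp
  rw [e]
  obtain ⟨hre, him⟩ := Complex.le_def.mp h1
  refine ⟨Complex.ext (by simp) ?_, by simpa using hre⟩
  simpa using him.symm

/-- A linear functional between zero and the trace on positive semidefinite matrices is given
by a test. -/
theorem exists_test_of_functional (φ : Matrix n n ℂ →ₗ[ℂ] ℂ)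
    (h0 : ∀ X : Matrix n n ℂ, X.PosSemidef → 0 ≤ φ X)
    (h1 : ∀ X : Matrix n n ℂ, X.PosSemidef → φ X ≤ X.trace) :
    ∃ Λ : Matrix n n ℂ, 0 ≤ Λ ∧ Λ ≤ 1 ∧ ∀ X, (Λ * X).trace = φ X := by
  let Λ : Matrix n n ℂ := Matrix.of fun j i => φ (single i j 1)
  have key : ∀ X, (Λ * X).trace = φ X := by
    intro X
    conv_rhs => rw [matrix_eq_sum_single X]
    simp only [map_sum, trace, diag, mul_apply, Λ, of_apply]
    rw [Finset.sum_comm]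
    refine Finset.sum_congr rfl fun i _ => Finset.sum_congr rfl fun j _ => ?_
    rw [show single i j (X i j) = X i j • single i j (1 : ℂ) by simp, map_smul, smul_eq_mul,
      mul_comm]
  refine ⟨Λ, (posSemidef_of_trace_mul_nonneg fun X hX => ?_).nonneg,
    Matrix.le_iff.mpr (posSemidef_of_trace_mul_nonneg fun X hX => ?_), key⟩
  · rw [key]; exact h0 X hX
  · rw [sub_mul, one_mul, trace_sub, key, sub_nonneg]; exact h1 X hX

/-- A linear identity that holds on states extends to all matrices. -/
theorem eq_trace_smul_of_forall_state {V : Type v} [AddCommGroup V] [Module ℂ V]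
    (Φ : Matrix n n ℂ →ₗ[ℂ] V) (y : V) (h : ∀ ρ : Matrix n n ℂ, IsState ρ → Φ ρ = y)
    (X : Matrix n n ℂ) : Φ X = X.trace • y := by
  have hX : X ∈ Submodule.span ℂ {M : Matrix n n ℂ | 0 ≤ M} := by
    rw [CStarAlgebra.span_nonneg]; trivial
  induction hX using Submodule.span_induction with
  | mem M hM =>
    have hM' : M.PosSemidef := Matrix.nonneg_iff_posSemidef.mp hM
    by_cases ht : M.trace = 0
    · rw [hM'.trace_eq_zero_iff.mp ht]; simp
    · have hs : IsState (M.trace⁻¹ • M) :=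
        ⟨hM'.smul (inv_nonneg.mpr hM'.trace_nonneg), by simp [trace_smul, ht]⟩
      rw [← h _ hs, map_smul, smul_smul, mul_inv_cancel₀ ht, one_smul]
  | zero => simp
  | add M N _ _ hM hN => rw [map_add, hM, hN, trace_add, add_smul]
  | smul c M _ hM => rw [map_smul, hM, trace_smul, smul_smul, smul_eq_mul]

end Effects

/-! ### Free operations -/

section CUCO
variable {A : Type u} {B : Type v} {A' : Type w} {B' : Type x}
  [Fintype A] [DecidableEq A] [Fintype B] [Fintype A'] [DecidableEq A'] [Fintype B']
  {N : Matrix (A × B) (A × B) ℂ →ₗ[ℂ] Matrix (A' × B') (A' × B') ℂ}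

theorem IsCUCO.posSemidef (hN : IsCUCO N) {M : Matrix (A × B) (A × B) ℂ} (hM : M.PosSemidef) :
    (N M).PosSemidef := by
  obtain ⟨k, E, F, hE, hF, hNM, -⟩ := hN
  rw [hNM]
  exact hF.tensorId_posSemidef ((hE.idTensor_posSemidef hM).submatrix _)

/-- A free operation does not signal from Alice to Bob: Bob's output is a channel applied to his
input. -/
theorem IsCUCO.exists_trFst_eq (hN : IsCUCO N) : ∃ E : Matrix B B ℂ →ₗ[ℂ] Matrix B' B' ℂ,
    (∀ M, (E M).trace = M.trace) ∧ ∀ M, trFst (N M) = E (trFst M) := by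
  obtain ⟨k, E, F, hE, hF, hNM, -⟩ := hN
  refine ⟨⟨⟨fun M => trFst (E M), fun M M' => ?_⟩, fun c M => ?_⟩, fun M => ?_, fun M => ?_⟩
  · ext i j; simp [trFst, Finset.sum_add_distrib]
  · ext i j; simp [trFst, Finset.mul_sum]
  · exact (trace_trFst (E M)).trans (hE.tracePreserving M)
  · rw [hNM, trFst_tensorId hF]
    have : trFst M = ∑ a, M.submatrix (fun b => (a, b)) (fun b => (a, b)) := by
      ext b b'
      simp [trFst, Matrix.sum_apply]
    ext i j
    rw [this]
    simp only [LinearMap.coe_mk, AddHom.coe_mk, map_sum, trFst, of_apply, Matrix.sum_apply,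
      Fintype.sum_prod_type]
    rfl

theorem IsCUCO.trace_eq (hN : IsCUCO N) (M : Matrix (A × B) (A × B) ℂ) :
    (N M).trace = M.trace := by
  obtain ⟨E, hE, h⟩ := hN.exists_trFst_eq
  rw [← trace_trFst, h, hE, trace_trFst]

theorem IsCUCO.isState (hN : IsCUCO N) {ρ : Matrix (A × B) (A × B) ℂ} (hρ : IsState ρ) :
    IsState (N ρ) := ⟨hN.posSemidef hρ.1, (hN.trace_eq ρ).trans hρ.2⟩

/-- A free operation keeps Alice's system uniform and uncorrelated with Bob's. -/
theorem IsCUCO.apply_uniform_kronecker (hN : IsCUCO N) (σ : Matrix B B ℂ) :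
    N (uniform A ⊗ₖ σ) = uniform A' ⊗ₖ trFst (N (uniform A ⊗ₖ σ)) := by
  obtain ⟨k, E, F, hE, hF, hNM, hu⟩ := hN
  let Φ : Matrix (Fin k) (Fin k) ℂ →ₗ[ℂ] Matrix A' A' ℂ :=
    F ∘ₗ kroneckerBilinear (R := ℂ) (uniform A)
  have hΦ : ∀ X, F (uniform A ⊗ₖ X) = X.trace • uniform A' :=
    eq_trace_smul_of_forall_state Φ _ hu
  rw [hNM, trFst_tensorId hF]
  have hE' : ∀ b b' : B', (Matrix.of fun y y' : A × Fin k =>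
      (reindex (Equiv.prodAssoc A (Fin k) B').symm (Equiv.prodAssoc A (Fin k) B').symm
        (idTensor A E (uniform A ⊗ₖ σ))) (y, b) (y', b')) =
      uniform A ⊗ₖ Matrix.of fun i i' => E σ (i, b) (i', b') := by
    intro b b'
    ext ⟨a, i⟩ ⟨a', i'⟩
    have : (Matrix.of fun y y' => (uniform A ⊗ₖ σ) (a, y) (a', y')) = uniform A a a' • σ := by
      ext; rfl
    have h2 := congrFun (congrFun (congrArg E this) (i, b)) (i', b')
    rw [map_smul] at h2
    exact h2
  ext ⟨i, b⟩ ⟨i', b'⟩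
  have e : trFst (reindex (Equiv.prodAssoc A (Fin k) B').symm (Equiv.prodAssoc A (Fin k) B').symm
        (idTensor A E (uniform A ⊗ₖ σ))) b b' =
      (uniform A ⊗ₖ Matrix.of fun i i' => E σ (i, b) (i', b')).trace := by
    rw [← hE']; rfl
  rw [kroneckerMap_apply, e, ← hF.tracePreserving, hΦ]
  simp only [tensorId, of_apply]
  rw [hE', hΦ, trace_smul]
  by_cases hA' : Nonempty A'
  · rw [uniform_isState.2]
    simp [mul_comm]
  · exact absurd ⟨i⟩ hA'

/-- The map in which Bob applies `E`, sends the system `K` to Alice, and Alice applies `F`. -/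
def sendAndApply {K : Type*} (E : Matrix B B ℂ →ₗ[ℂ] Matrix (K × B') (K × B') ℂ)
    (F : Matrix (A × K) (A × K) ℂ →ₗ[ℂ] Matrix A' A' ℂ) :
    Matrix (A × B) (A × B) ℂ →ₗ[ℂ] Matrix (A' × B') (A' × B') ℂ where
  toFun M := Matrix.of fun p q => F (Matrix.of fun y y' : A × K =>
    E (Matrix.of fun z z' => M (y.1, z) (y'.1, z')) (y.2, p.2) (y'.2, q.2)) p.1 q.1
  map_add' M M' := by
    ext p q
    simp only [of_apply, Matrix.add_apply]
    rw [← Matrix.add_apply, ← map_add]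
    refine congrArg (fun X => F X p.1 q.1) ?_
    ext y y'
    simp only [of_apply, Matrix.add_apply]
    rw [← Matrix.add_apply, ← map_add]
    rfl
  map_smul' c M := by
    ext p q
    simp only [of_apply, Matrix.smul_apply, RingHom.id_apply]
    rw [← Matrix.smul_apply, ← map_smul]
    refine congrArg (fun X => F X p.1 q.1) ?_
    ext y y'
    simp only [of_apply, Matrix.smul_apply]
    rw [← Matrix.smul_apply, ← map_smul]
    rfl

omit [Fintype A] [DecidableEq A] [Fintype B] [Fintype A'] [DecidableEq A'] [Fintype B'] in
theorem sendAndApply_apply {K : Type*} (E : Matrix B B ℂ →ₗ[ℂ] Matrix (K × B') (K × B') ℂ)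
    (F : Matrix (A × K) (A × K) ℂ →ₗ[ℂ] Matrix A' A' ℂ) (M : Matrix (A × B) (A × B) ℂ)
    (p q : A' × B') : sendAndApply E F M p q = F (Matrix.of fun y y' : A × K =>
      E (Matrix.of fun z z' => M (y.1, z) (y'.1, z')) (y.2, p.2) (y'.2, q.2)) p.1 q.1 := rfl

/-- The system `B''` in the definition of a free operation may be any finite type. -/
theorem sendAndApply_isCUCO {K : Type*} [Fintype K]
    {E : Matrix B B ℂ →ₗ[ℂ] Matrix (K × B') (K × B') ℂ}
    {F : Matrix (A × K) (A × K) ℂ →ₗ[ℂ] Matrix A' A' ℂ} (hE : IsChannel E) (hF : IsChannel F)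
    (hu : ∀ ρ : Matrix K K ℂ, IsState ρ → F (uniform A ⊗ₖ ρ) = uniform A') :
    IsCUCO (sendAndApply E F) := by
  let e := Fintype.equivFin K
  refine ⟨Fintype.card K, relabel (e.prodCongr (Equiv.refl B')) ∘ₗ E,
    F ∘ₗ relabel ((Equiv.refl A).prodCongr e.symm), (relabel_isChannel _).comp hE,
    hF.comp (relabel_isChannel _), fun M => ?_, fun ρ hρ => ?_⟩
  · ext ⟨i, b⟩ ⟨i', b'⟩
    rw [sendAndApply_apply]
    simp only [tensorId, of_apply, LinearMap.comp_apply]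
    refine congrArg (fun X => F X i i') ?_
    ext ⟨y, l⟩ ⟨y', l'⟩
    simp [relabel_apply, idTensor]
  · have hs : IsState (ρ.submatrix e e) := by
      refine ⟨hρ.1.submatrix _, ?_⟩
      rw [← hρ.2]
      exact e.sum_comp fun i => ρ i i
    rw [← hu _ hs]
    rfl

end CUCO

/-! ### Free operations that prepare a state -/

section LocalOperators
variable {Q : Type u} {B : Type v} [Fintype Q] [DecidableEq Q] [Fintype B]

theorem one_kronecker_mul_mul_apply (K L : Matrix B B ℂ) (M : Matrix (Q × B) (Q × B) ℂ)
    (q q' : Q) (b b' : B) :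
    (((1 : Matrix Q Q ℂ) ⊗ₖ K) * M * ((1 : Matrix Q Q ℂ) ⊗ₖ L)) (q, b) (q', b') =
      ∑ i, ∑ j, K b i * M (q, i) (q', j) * L j b' := by
  simp only [mul_apply, Fintype.sum_prod_type, kroneckerMap_apply, one_apply, ite_mul, one_mul,
    zero_mul, mul_ite, mul_zero, Finset.sum_ite_irrel, Finset.sum_const_zero, Finset.sum_ite_eq',
    Finset.sum_ite_eq, Finset.mem_univ, if_true, Finset.sum_mul]
  exact Finset.sum_comm

theorem trFst_one_kronecker_mul_mul (K L : Matrix B B ℂ) (M : Matrix (Q × B) (Q × B) ℂ) :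
    trFst (((1 : Matrix Q Q ℂ) ⊗ₖ K) * M * ((1 : Matrix Q Q ℂ) ⊗ₖ L)) = K * trFst M * L := by
  ext b b'
  refine (Finset.sum_congr rfl fun a _ => one_kronecker_mul_mul_apply K L M a a b b').trans ?_
  simp only [trFst, of_apply, mul_apply, Finset.sum_mul, Finset.mul_sum]
  rw [Finset.sum_comm]
  conv_lhs => enter [2, i]; rw [Finset.sum_comm]
  exact Finset.sum_comm

end LocalOperators

section Prepare
variable {P : Type u} {Q : Type v} {B : Type w} [Fintype P] [DecidableEq P] [Fintype Q]
  [DecidableEq Q] [Fintype B] [DecidableEq B]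

/-- The Choi matrix `τ_B^{-1/2} τ τ_B^{-1/2}` of the channel `B → Q` that steers the purification
of `τ_B` to `τ`, completed off the support of `τ_B` by the channel with uniform output. -/
def steeringChoi (τ : Matrix (Q × B) (Q × B) ℂ) : Matrix (Q × B) (Q × B) ℂ :=
  ((1 : Matrix Q Q ℂ) ⊗ₖ invSqrt (trFst τ)) * τ * ((1 : Matrix Q Q ℂ) ⊗ₖ invSqrt (trFst τ)) +
    uniform Q ⊗ₖ (1 - supportProj (trFst τ))

omit [Fintype Q] [Fintype B] [DecidableEq B] in
theorem one_kronecker_isHermitian {K : Matrix B B ℂ} (hK : K.IsHermitian) :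
    ((1 : Matrix Q Q ℂ) ⊗ₖ K).IsHermitian := by
  rw [IsHermitian, conjTranspose_kronecker, conjTranspose_one, hK.eq]

omit [DecidableEq B] in
theorem conj_one_kronecker_le {M N : Matrix (Q × B) (Q × B) ℂ} (h : M ≤ N) {K : Matrix B B ℂ}
    (hK : K.IsHermitian) : ((1 : Matrix Q Q ℂ) ⊗ₖ K) * M * ((1 : Matrix Q Q ℂ) ⊗ₖ K) ≤
      ((1 : Matrix Q Q ℂ) ⊗ₖ K) * N * ((1 : Matrix Q Q ℂ) ⊗ₖ K) := by
  simpa only [(one_kronecker_isHermitian (Q := Q) hK).eq] using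
    conj_le_conj h ((1 : Matrix Q Q ℂ) ⊗ₖ K)

omit [DecidableEq B] in
theorem one_kronecker_mul_kronecker_mul (K L X : Matrix B B ℂ) (Y : Matrix Q Q ℂ) :
    ((1 : Matrix Q Q ℂ) ⊗ₖ K) * (Y ⊗ₖ X) * ((1 : Matrix Q Q ℂ) ⊗ₖ L) = Y ⊗ₖ (K * X * L) := by
  rw [← mul_kronecker_mul, ← mul_kronecker_mul, one_mul, mul_one]

theorem one_sub_supportProj_posSemidef (σ : Matrix B B ℂ) : (1 - supportProj σ).PosSemidef :=
  Matrix.le_iff.mp (supportProj_le_one σ)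

theorem uniform_posSemidef : (uniform Q).PosSemidef := PosSemidef.one.smul (by positivity)

theorem steeringChoi_posSemidef {τ : Matrix (Q × B) (Q × B) ℂ} (hτ : IsState τ) :
    (steeringChoi τ).PosSemidef := by
  refine PosSemidef.add ?_ (uniform_posSemidef.kronecker (one_sub_supportProj_posSemidef _))
  simpa only [(one_kronecker_isHermitian (Q := Q) (invSqrt_isHermitian (trFst τ))).eq] using
    hτ.1.mul_mul_conjTranspose_same ((1 : Matrix Q Q ℂ) ⊗ₖ invSqrt (trFst τ))

theorem trFst_steeringChoi {τ : Matrix (Q × B) (Q × B) ℂ} (hτ : IsState τ) :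
    trFst (steeringChoi τ) = 1 := by
  have : Nonempty Q := hτ.nonempty.map Prod.fst
  rw [steeringChoi, trFst_add, trFst_one_kronecker_mul_mul, trFst_kronecker, uniform_isState.2,
    one_smul, invSqrt_mul_mul_invSqrt hτ.trFst.1, add_sub_cancel]

theorem steeringChoi_le {τ : Matrix (Q × B) (Q × B) ℂ} (hτ : IsState τ) {D : ℝ} (hD : 1 ≤ D)
    (h : τ ≤ D • (uniform Q ⊗ₖ trFst τ)) :
    steeringChoi τ ≤ D • (uniform Q ⊗ₖ (1 : Matrix B B ℂ)) := by
  have h1 := conj_one_kronecker_le h (invSqrt_isHermitian (trFst τ))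
  rw [Matrix.mul_smul, Matrix.smul_mul, one_kronecker_mul_kronecker_mul,
    invSqrt_mul_mul_invSqrt hτ.trFst.1] at h1
  have h2 : uniform Q ⊗ₖ (1 - supportProj (trFst τ)) ≤
      D • (uniform Q ⊗ₖ (1 - supportProj (trFst τ))) := by
    rw [Matrix.le_iff]
    have := (uniform_posSemidef (Q := Q).kronecker
      (one_sub_supportProj_posSemidef (trFst τ))).smul (sub_nonneg.mpr hD)
    rwa [sub_smul, one_smul] at this
  have h3 := add_le_add h1 h2
  rwa [← smul_add, ← kronecker_add, add_sub_cancel] at h3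

theorem psdSqrt_conj_steeringChoi {τ : Matrix (Q × B) (Q × B) ℂ} (hτ : IsState τ) {D : ℝ}
    (h : τ ≤ D • (uniform Q ⊗ₖ trFst τ)) :
    ((1 : Matrix Q Q ℂ) ⊗ₖ psdSqrt (trFst τ)) * steeringChoi τ *
      ((1 : Matrix Q Q ℂ) ⊗ₖ psdSqrt (trFst τ)) = τ := by
  have hσ := hτ.trFst.1
  set σ := trFst τ with hσd
  have hR : psdSqrt σ * (1 - supportProj σ) * psdSqrt σ = 0 := by
    rw [mul_sub, mul_one, sub_mul, psdSqrt_mul_psdSqrt hσ, ← psdSqrt_mul_invSqrt hσ,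
      ← mul_assoc, psdSqrt_mul_psdSqrt hσ, mul_assoc, invSqrt_mul_psdSqrt hσ,
      mul_supportProj_of_ker_le hσ.1 fun _ h => h, sub_self]
  have hPh := (one_sub_supportProj_posSemidef σ).1
  -- the support of `τ` lies in that of `𝟙 ⊗ τ_B`
  have hker : ((1 : Matrix Q Q ℂ) ⊗ₖ (1 - supportProj σ)) * τ = 0 := by
    refine mul_eq_zero_of_conj_eq_zero hτ.1 (le_antisymm ?_
      (hτ.1.mul_mul_conjTranspose_same _).nonneg)
    rw [(one_kronecker_isHermitian (Q := Q) hPh).eq]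
    have h1 := conj_one_kronecker_le h hPh
    rw [Matrix.mul_smul, Matrix.smul_mul, one_kronecker_mul_kronecker_mul] at h1
    have : (1 - supportProj σ) * σ = 0 := by
      rw [sub_mul, one_mul, supportProj_mul_self hσ.1, sub_self]
    rwa [this, zero_mul, kronecker_zero, smul_zero] at h1
  have e1 : ((1 : Matrix Q Q ℂ) ⊗ₖ supportProj σ) * τ = τ := by
    have : (1 : Matrix Q Q ℂ) ⊗ₖ supportProj σ =
        1 - (1 : Matrix Q Q ℂ) ⊗ₖ (1 - supportProj σ) := by
      rw [eq_sub_iff_add_eq, ← kronecker_add, add_sub_cancel, one_kronecker_one]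
    rw [this, sub_mul, one_mul, hker, sub_zero]
  have e2 : τ * ((1 : Matrix Q Q ℂ) ⊗ₖ supportProj σ) = τ := by
    have := congrArg conjTranspose e1
    rwa [conjTranspose_mul, hτ.1.1.eq,
      (one_kronecker_isHermitian (Q := Q) (supportProj_posSemidef σ).1).eq] at this
  have e3 : ((1 : Matrix Q Q ℂ) ⊗ₖ psdSqrt σ) * ((1 : Matrix Q Q ℂ) ⊗ₖ invSqrt σ) =
      (1 : Matrix Q Q ℂ) ⊗ₖ supportProj σ := by
    rw [← mul_kronecker_mul, one_mul, psdSqrt_mul_invSqrt hσ]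
  have e4 : ((1 : Matrix Q Q ℂ) ⊗ₖ invSqrt σ) * ((1 : Matrix Q Q ℂ) ⊗ₖ psdSqrt σ) =
      (1 : Matrix Q Q ℂ) ⊗ₖ supportProj σ := by
    rw [← mul_kronecker_mul, one_mul, invSqrt_mul_psdSqrt hσ]
  rw [steeringChoi, ← hσd, mul_add, add_mul, one_kronecker_mul_kronecker_mul, hR, kronecker_zero,
    add_zero, ← mul_assoc, ← mul_assoc, e3, e1, mul_assoc, e4, e2]

/-- The canonical purification of `σ`, as a vector on two copies of `B`. -/
def purification (σ : Matrix B B ℂ) : Matrix (B × B) (B × B) ℂ :=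
  vecMulVec (fun x => psdSqrt σ x.2 x.1) (star fun x => psdSqrt σ x.2 x.1)

theorem purification_apply (σ : Matrix B B ℂ) (x y : B × B) :
    purification σ x y = psdSqrt σ x.2 x.1 * psdSqrt σ y.1 y.2 := by
  have := congrFun (congrFun (psdSqrt_isHermitian σ).eq y.1) y.2
  rw [conjTranspose_apply] at this
  rw [purification, vecMulVec_apply, Pi.star_apply, this]

theorem purification_isState {σ : Matrix B B ℂ} (hσ : IsState σ) : IsState (purification σ) := by
  refine ⟨posSemidef_vecMulVec_self_star _, ?_⟩
  rw [← hσ.2]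
  conv_rhs => rw [← psdSqrt_mul_psdSqrt hσ.1]
  simp only [trace, diag, purification_apply, mul_apply, Fintype.sum_prod_type]
  exact Finset.sum_comm

omit [Fintype B] [DecidableEq B] in
theorem uniform_kronecker_submatrix (Y : Matrix B B ℂ) (p : P) :
    (uniform P ⊗ₖ Y).submatrix (fun i => (p, i)) (fun i => (p, i)) =
      (Fintype.card P : ℂ)⁻¹ • Y := by
  ext i j
  simp [uniform]

/-- If `τ ≤ D π ⊗ τ_B`, with `D ≥ 2` the dimension of the initial system `P`, a free operation
turns a pure state of `P` into `τ`. Bob sends the purifying system of `τ_B`; if Alice finds her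
system in the pure state she steers it to `τ`, and otherwise she applies the channel that
restores uniformity, which the inequality makes completely positive. -/
theorem exists_isCUCO_prepare (p₀ : P) (hP : 2 ≤ Fintype.card P) {τ : Matrix (Q × B) (Q × B) ℂ}
    (hτ : IsState τ) (h : τ ≤ (Fintype.card P : ℝ) • (uniform Q ⊗ₖ trFst τ)) :
    ∃ N : Matrix (P × Unit) (P × Unit) ℂ →ₗ[ℂ] Matrix (Q × B) (Q × B) ℂ,
      IsCUCO N ∧ N (ket (p₀, ())) = τ := by
  have : Nonempty Q := hτ.nonempty.map Prod.fst
  have hD : (2 : ℝ) ≤ Fintype.card P := by exact_mod_cast hP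
  set D : ℝ := ((Fintype.card P : ℕ) : ℝ) with hDd
  set J := steeringChoi τ with hJ
  have hJp : J.PosSemidef := steeringChoi_posSemidef hτ
  have hJt : trFst J = 1 := trFst_steeringChoi hτ
  -- the Choi matrix for the other `D - 1` outcomes; the average over a uniform input is uniform
  set J' := (D - 1)⁻¹ • (D • (uniform Q ⊗ₖ (1 : Matrix B B ℂ)ᵀ) - J) with hJ'
  have hJp' : J'.PosSemidef := by
    refine PosSemidef.smul ?_ (inv_nonneg.mpr (by linarith))
    have := Matrix.le_iff.mp (steeringChoi_le hτ (by linarith) h)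
    rwa [transpose_one]
  have hJt' : trFst J' = 1 := by
    rw [hJ', trFst_smul, trFst_sub, trFst_smul, trFst_kronecker, uniform_isState.2, hJt,
      transpose_one, one_smul]
    rw [show D • (1 : Matrix B B ℂ) - 1 = (D - 1) • 1 by rw [sub_smul, one_smul], smul_smul,
      inv_mul_cancel₀ (by linarith), one_smul]
  let Φ : P → Matrix B B ℂ →ₗ[ℂ] Matrix Q Q ℂ := fun p => if p = p₀ then choiMap J else choiMap J'
  have hΦ : ∀ p, IsChannel (Φ p) := by
    intro p
    by_cases hp : p = p₀
    · simpa [Φ, hp] using choiMap_isChannel hJp hJt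
    · simpa [Φ, hp] using choiMap_isChannel hJp' hJt'
  let E := choiMap (purification (trFst τ) ⊗ₖ (1 : Matrix Unit Unit ℂ)ᵀ)
  refine ⟨sendAndApply E (controlled (Equiv.refl (P × B)) Φ), sendAndApply_isCUCO
    (prepare_isChannel (purification_isState hτ.trFst)) (controlled_isChannel _ hΦ)
    fun ρ hρ => ?_, ?_⟩
  · rw [controlled_apply]
    simp only [Equiv.refl_apply, uniform_kronecker_submatrix, map_smul]
    rw [← Finset.smul_sum, ← Finset.add_sum_erase _ _ (Finset.mem_univ p₀)]
    have hrest : ∑ p ∈ Finset.univ.erase p₀, Φ p ρ = (D - 1) • choiMap J' ρ := by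
      rw [Finset.sum_congr rfl (g := fun _ => choiMap J' ρ), Finset.sum_const,
        Finset.card_erase_of_mem (Finset.mem_univ _), Finset.card_univ,
        ← Nat.cast_smul_eq_nsmul ℝ, Nat.cast_sub (by omega), Nat.cast_one]
      intro p hp
      simp [Φ, Finset.ne_of_mem_erase hp]
    have h0 : Φ p₀ ρ = choiMap J ρ := by simp [Φ]
    rw [hrest, h0, hJ', choiMap_smul, choiMap_sub, choiMap_smul, choiMap_kronecker_transpose,
      smul_smul, mul_inv_cancel₀ (by linarith), one_smul, add_sub_cancel, one_mul, hρ.2, one_smul]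
    have : ((Fintype.card P : ℕ) : ℂ)⁻¹ • (D • uniform Q) = (D⁻¹ * D) • uniform Q := by
      ext i j
      simp [hDd, mul_assoc]
    rw [this, inv_mul_cancel₀ (by linarith), one_smul]
  · ext ⟨q, b⟩ ⟨q', b'⟩
    rw [sendAndApply_apply, controlled_apply]
    have hE : ∀ y y' : P, E (Matrix.of fun z z' : Unit => ket (p₀, ()) (y, z) (y', z')) =
        (if y = p₀ ∧ y' = p₀ then (1 : ℂ) else 0) • purification (trFst τ) := by
      intro y y'
      simp only [E]
      rw [choiMap_kronecker_transpose, one_mul]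
      simp [trace, ket, single_apply, eq_comm]
    simp only [hE]
    rw [Finset.sum_eq_single p₀]
    · simp only [Φ, if_true]
      rw [choiMap_apply]
      conv_rhs => rw [← psdSqrt_conj_steeringChoi hτ h, one_kronecker_mul_mul_apply]
      refine Finset.sum_congr rfl fun i _ => Finset.sum_congr rfl fun j _ => ?_
      simp [purification_apply]
      ring
    · intro p _ hp
      have : ((Matrix.of fun y y' : P × B => ((if y.1 = p₀ ∧ y'.1 = p₀ then (1 : ℂ) else 0) •
          purification (trFst τ)) (y.2, b) (y'.2, b')).submatrix
            (fun i => (Equiv.refl (P × B)) (p, i)) fun i => (Equiv.refl (P × B)) (p, i)) = 0 := by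
        ext i j
        simp [hp]
      rw [this, map_zero]
    · simp

end Prepare

/-! ### Free operations that erase a system -/

section Ket
variable {n : Type u} [Fintype n] [DecidableEq n]

omit [Fintype n] in
theorem ket_eq_diagonal (x : n) : ket x = diagonal (Pi.single x 1) := by
  rw [ket, diagonal_single]

theorem ket_isState (x : n) : IsState (ket x) := by
  refine ⟨?_, by simp [ket]⟩
  rw [ket_eq_diagonal]
  refine PosSemidef.diagonal fun i => ?_
  by_cases h : i = x
  · subst h; simp
  · simp [h]

theorem ket_mul_self (x : n) : ket x * ket x = ket x := by simp [ket]

/-- The state that is uniform on the basis vectors other than `x`. -/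
def uniformCompl (x : n) : Matrix n n ℂ :=
  ((Fintype.card n : ℝ) - 1)⁻¹ • (1 - ket x)

theorem uniformCompl_isState (x : n) (hn : 2 ≤ Fintype.card n) : IsState (uniformCompl x) := by
  have h : (2 : ℝ) ≤ Fintype.card n := by exact_mod_cast hn
  refine ⟨(Matrix.le_iff.mp (ket_isState x).le_one).smul (inv_nonneg.mpr (by linarith)), ?_⟩
  have h' : ((Fintype.card n : ℂ) - 1) ≠ 0 := by
    rw [sub_ne_zero]
    exact_mod_cast (by omega : Fintype.card n ≠ 1)
  rw [uniformCompl, trace_smul, trace_sub, trace_one, (ket_isState x).2, Complex.real_smul]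
  push_cast
  exact inv_mul_cancel₀ h'

end Ket

section Erase
variable {A : Type u} {B : Type v} {Q : Type w} [Fintype A] [DecidableEq A] [Fintype B]
  [DecidableEq B] [Fintype Q] [DecidableEq Q]

omit [Fintype A] [DecidableEq A] [Fintype B] [DecidableEq B] in
theorem withBattery_submatrix (m : ℕ) [NeZero m] (ρ : Matrix (A × B) (A × B) ℂ) (p : Fin m) :
    (withBattery m ρ).submatrix (fun i => (Equiv.prodAssoc (Fin m) A B).symm (p, i))
      (fun i => (Equiv.prodAssoc (Fin m) A B).symm (p, i)) = if p = 0 then ρ else 0 := by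
  ext i j
  by_cases h : p = 0
  · simp [withBattery, ket, h]
  · simp [withBattery, ket, h, Ne.symm h]

/-- A matrix bounded by `r` on every state is at most `r 𝟙`. -/
theorem le_smul_one_of_forall_state {M : Matrix B B ℂ} (hM : M.PosSemidef) {r : ℝ}
    (h : ∀ σ : Matrix B B ℂ, IsState σ → (M * σ).trace.re ≤ r) : M ≤ r • 1 := by
  rw [Matrix.le_iff]
  refine posSemidef_of_trace_mul_nonneg fun X hX => ?_
  by_cases ht : X.trace = 0
  · rw [hX.trace_eq_zero_iff.mp ht]; simp
  · obtain ⟨t, ht0, hXt⟩ : ∃ t : ℝ, 0 ≤ t ∧ X.trace = t :=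
      ⟨X.trace.re, trace_re_nonneg hX,
        Complex.ext rfl (by simpa using (Complex.le_def.mp hX.trace_nonneg).2.symm)⟩
    have hs : IsState (X.trace⁻¹ • X) :=
      ⟨hX.smul (inv_nonneg.mpr hX.trace_nonneg), by simp [trace_smul, ht]⟩
    have h1 := h _ hs
    have ht0' : 0 < t := lt_of_le_of_ne ht0 fun h => ht (by rw [hXt, ← h]; simp)
    rw [Matrix.mul_smul, trace_smul, hXt, smul_eq_mul, ← Complex.ofReal_inv,
      Complex.re_ofReal_mul, inv_mul_le_iff₀ ht0'] at h1
    have h2 := (Complex.le_def.mp (trace_mul_nonneg hM hX)).2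
    rw [sub_mul, smul_mul_assoc, one_mul, trace_sub, trace_smul, hXt, Complex.real_smul]
    rw [Complex.le_def]
    constructor
    · simpa [mul_comm] using h1
    · simpa using h2.symm

/-- If the test `Λ` satisfies `Tr_A Λ ≤ m |A| / |Q|`, a free operation with an initial battery of
dimension `m` produces the pure state `q₀` of `Q` with probability `Tr[Λ ρ]`. Alice performs `Λ`
when the battery is in its ground state; otherwise she performs a test of Bob's system alone,
chosen so that on a uniform input the acceptance probability is `1 / |Q|` for every state of
Bob. -/
theorem exists_isCUCO_erase (m : ℕ) [NeZero m] (hm : 2 ≤ m) (q₀ : Q) (hQ : 2 ≤ Fintype.card Q)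
    [Nonempty A] {Λ : Matrix (A × B) (A × B) ℂ} (h0 : 0 ≤ Λ) (h1 : Λ ≤ 1)
    (hΛ : trFst Λ ≤ ((m * Fintype.card A : ℝ) / Fintype.card Q) • 1) :
    ∃ N : Matrix ((Fin m × A) × B) ((Fin m × A) × B) ℂ →ₗ[ℂ] Matrix (Q × Unit) (Q × Unit) ℂ,
      IsCUCO N ∧ ∀ ρ : Matrix (A × B) (A × B) ℂ, ∀ i j, N (withBattery m ρ) (i, ()) (j, ()) =
        ((Λ * ρ).trace • ket q₀ + (ρ.trace - (Λ * ρ).trace) • uniformCompl q₀) i j := by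
  have hmR : (2 : ℝ) ≤ m := by exact_mod_cast hm
  have hQR : (2 : ℝ) ≤ Fintype.card Q := by exact_mod_cast hQ
  have hAR : (1 : ℝ) ≤ Fintype.card A := by exact_mod_cast Fintype.card_pos (α := A)
  set a : ℝ := ((Fintype.card A : ℕ) : ℝ) with ha
  set d : ℝ := ((Fintype.card Q : ℕ) : ℝ) with hd
  set r : ℝ := m * a / d with hr
  have hs : (0 : ℝ) < (m - 1) * a := mul_pos (by linarith) (by linarith)
  -- this keeps the complementary test below `𝟙`, and needs both dimensions to be at least two
  have hrs : r ≤ (m - 1) * a := by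
    rw [hr, div_le_iff₀ (by linarith)]
    have : (0 : ℝ) ≤ ((m - 1) * d - m) := by nlinarith
    nlinarith
  -- the `m - 1` excited battery levels and the basis of `A` share the missing weight equally
  let K : Matrix B B ℂ := ((m - 1) * a)⁻¹ • (r • 1 - trFst Λ)
  have hK0 : K.PosSemidef := (Matrix.le_iff.mp hΛ).smul (inv_nonneg.mpr hs.le)
  have hK1 : K ≤ 1 := by
    have e : 1 - K = ((m - 1) * a)⁻¹ • (((m - 1) * a - r) • 1 + trFst Λ) := by
      simp only [K]
      rw [sub_smul, sub_add, smul_sub (((m : ℝ) - 1) * a)⁻¹ ((((m : ℝ) - 1) * a) • (1 : Matrix B B ℂ)),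
        smul_smul, inv_mul_cancel₀ hs.ne', one_smul]
    rw [Matrix.le_iff, e]
    exact ((PosSemidef.one.smul (sub_nonneg.mpr hrs)).add
      (trFst_posSemidef h0.posSemidef)).smul (inv_nonneg.mpr hs.le)
  let Θ : Matrix (A × B) (A × B) ℂ := (1 : Matrix A A ℂ) ⊗ₖ K
  have hΘ0 : 0 ≤ Θ := (PosSemidef.one.kronecker hK0).nonneg
  have hΘ1 : Θ ≤ 1 := by
    have := PosSemidef.one.kronecker (Matrix.le_iff.mp hK1) (x := (1 : Matrix A A ℂ))
    rw [Matrix.le_iff]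
    have e : (1 : Matrix A A ℂ) ⊗ₖ (1 - K) = 1 - Θ := by
      rw [eq_sub_iff_add_eq, ← kronecker_add, sub_add_cancel, one_kronecker_one]
    rwa [e] at this
  let Ψ : Fin m → Matrix (A × B) (A × B) ℂ →ₗ[ℂ] Matrix Q Q ℂ := fun p =>
    testAndPrepare (if p = 0 then Λ else Θ) (ket q₀) (uniformCompl q₀)
  have hΨ : ∀ p, IsChannel (Ψ p) := fun p => by
    by_cases hp : p = 0
    · simpa [Ψ, hp] using testAndPrepare_isChannel h0 h1 (ket_isState q₀)
        (uniformCompl_isState q₀ hQ)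
    · simpa [Ψ, hp] using testAndPrepare_isChannel hΘ0 hΘ1 (ket_isState q₀)
        (uniformCompl_isState q₀ hQ)
  let F := controlled (Equiv.prodAssoc (Fin m) A B).symm Ψ
  refine ⟨sendAndApply (relabel (Equiv.prodPUnit B).symm) F,
    sendAndApply_isCUCO (relabel_isChannel _) (controlled_isChannel _ hΨ) fun σ hσ => ?_,
    fun ρ i j => ?_⟩
  · rw [controlled_apply]
    have hblock : ∀ p : Fin m, (uniform (Fin m × A) ⊗ₖ σ).submatrix
        (fun i => (Equiv.prodAssoc (Fin m) A B).symm (p, i))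
        (fun i => (Equiv.prodAssoc (Fin m) A B).symm (p, i)) =
          (m * a : ℂ)⁻¹ • ((1 : Matrix A A ℂ) ⊗ₖ σ) := by
      intro p
      ext i j
      simp [uniform, one_apply, ha]
    simp only [hblock, map_smul]
    rw [← Finset.smul_sum, ← Finset.add_sum_erase _ _ (Finset.mem_univ (0 : Fin m))]
    set t : ℂ := (trFst Λ * σ).trace with ht
    have htr : ((1 : Matrix A A ℂ) ⊗ₖ σ).trace = a := by
      rw [trace_kronecker, trace_one, hσ.2, mul_one]; simp [ha]
    have hm1 : ((m : ℂ) - 1) ≠ 0 := by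
      rw [sub_ne_zero]; exact_mod_cast (by omega : m ≠ 1)
    have ha0 : (a : ℂ) ≠ 0 := by exact_mod_cast (by linarith : a ≠ 0)
    have hd0 : (d : ℂ) ≠ 0 := by exact_mod_cast (by linarith : d ≠ 0)
    have hd1 : (d : ℂ) - 1 ≠ 0 := by
      rw [sub_ne_zero]; exact_mod_cast (by linarith : d ≠ 1)
    have hm0 : (m : ℂ) ≠ 0 := by exact_mod_cast (by omega : m ≠ 0)
    have hΨ0 : Ψ 0 ((1 : Matrix A A ℂ) ⊗ₖ σ) = t • ket q₀ + (a - t) • uniformCompl q₀ := by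
      simp only [Ψ, if_true]
      rw [testAndPrepare_apply, trace_mul_one_kronecker, htr]
    have hΘt : (Θ * ((1 : Matrix A A ℂ) ⊗ₖ σ)).trace = (m - 1 : ℂ)⁻¹ * (r - t) := by
      simp only [Θ, K]
      rw [← mul_kronecker_mul, trace_kronecker, one_mul, trace_one, smul_mul_assoc, trace_smul,
        Matrix.sub_mul, smul_mul_assoc, Matrix.one_mul, trace_sub, trace_smul, hσ.2, ← ht]
      simp only [Complex.real_smul, mul_one]
      have : ((Fintype.card A : ℕ) : ℂ) = a := by simp [ha]
      rw [this]
      push_cast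
      field_simp
    have hrest : ∑ p ∈ Finset.univ.erase (0 : Fin m), Ψ p ((1 : Matrix A A ℂ) ⊗ₖ σ) =
        (m - 1 : ℂ) • (((m - 1 : ℂ)⁻¹ * (r - t)) • ket q₀ +
          (a - (m - 1 : ℂ)⁻¹ * (r - t)) • uniformCompl q₀) := by
      rw [Finset.sum_congr rfl (g := fun _ => ((m - 1 : ℂ)⁻¹ * (r - t)) • ket q₀ +
          (a - (m - 1 : ℂ)⁻¹ * (r - t)) • uniformCompl q₀), Finset.sum_const,
        Finset.card_erase_of_mem (Finset.mem_univ _), Finset.card_univ, Fintype.card_fin,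
        ← Nat.cast_smul_eq_nsmul ℂ, Nat.cast_sub (by omega), Nat.cast_one]
      intro p hp
      simp only [Ψ, if_neg (Finset.ne_of_mem_erase hp)]
      rw [testAndPrepare_apply, hΘt, htr]
    rw [hrest, hΨ0]
    have hu : uniformCompl q₀ = (d - 1 : ℂ)⁻¹ • (1 - ket q₀) := by
      ext i j
      simp [uniformCompl, hd]
    have hun : uniform Q = (d : ℂ)⁻¹ • (1 : Matrix Q Q ℂ) := by simp [uniform, hd]
    have hrc : (r : ℂ) = m * a / d := by rw [hr]; push_cast; rfl
    rw [hu, hun, hrc]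
    ext i j
    simp only [Matrix.smul_apply, Matrix.add_apply, Matrix.sub_apply, smul_eq_mul]
    field_simp
    ring
  · have e : (Matrix.of fun y y' : (Fin m × A) × B => relabel (Equiv.prodPUnit B).symm
        (Matrix.of fun z z' => withBattery m ρ (y.1, z) (y'.1, z')) (y.2, ()) (y'.2, ())) =
        withBattery m ρ := by
      ext y y'; rfl
    rw [sendAndApply_apply]
    refine (congrArg (fun X => F X i j) e).trans ?_
    simp only [F]
    rw [controlled_apply]
    simp only [withBattery_submatrix]
    rw [Finset.sum_eq_single (0 : Fin m)]
    · simp only [Ψ, if_true]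
      rw [testAndPrepare_apply]
    · intro p _ hp
      rw [if_neg hp, map_zero]
    · simp

end Erase

/-! ### Bounds on the work cost -/

/-- Battery dimensions, as large as desired, realise every work value approximately. -/
theorem exists_ratio_between {s t : ℝ} (hs : 0 < s) (hst : s < t) (l : ℕ) :
    ∃ m n : ℕ, 2 ≤ m ∧ l ≤ n ∧ 2 ≤ n ∧ s ≤ (m : ℝ) / n ∧ (m : ℝ) / n ≤ t := by
  obtain ⟨k₁, hk₁⟩ := exists_nat_gt (1 / (t - s))
  obtain ⟨k₂, hk₂⟩ := exists_nat_gt (1 / s)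
  have hts : 0 < t - s := sub_pos.mpr hst
  let n := k₁ + k₂ + l + 2
  have hn : (0 : ℝ) < n := by positivity
  have c1 : ((k₁ : ℕ) : ℝ) ≤ n := by exact_mod_cast (by omega : k₁ ≤ n)
  have c2 : ((k₂ : ℕ) : ℝ) ≤ n := by exact_mod_cast (by omega : k₂ ≤ n)
  have h1 : 1 < n * (t - s) := (div_lt_iff₀ hts).mp (hk₁.trans_le c1)
  have h2 : 1 < n * s := (div_lt_iff₀ hs).mp (hk₂.trans_le c2)
  refine ⟨⌈n * s⌉₊, n, ?_, by omega, by omega, ?_, ?_⟩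
  · exact Nat.lt_ceil.mpr (by exact_mod_cast h2)
  · rw [le_div_iff₀ hn, mul_comm]
    exact Nat.le_ceil _
  · rw [div_le_iff₀ hn]
    have := Nat.ceil_lt_add_one (by positivity : 0 ≤ n * s)
    nlinarith

section PrepareBound
variable {P : Type u} {Q : Type v} {B : Type w} [Fintype P] [DecidableEq P] [Fintype Q]
  [DecidableEq Q] [Fintype B] [DecidableEq B]

/-- A free operation `P → QB` cannot produce a state of conditional min-entropy below
`log |Q| - log |P|`: its input is at most `|P|` times the uniform state. -/
theorem IsCUCO.le_HminDown [Nonempty Q]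
    {N : Matrix (P × Unit) (P × Unit) ℂ →ₗ[ℂ] Matrix (Q × B) (Q × B) ℂ} (hN : IsCUCO N)
    {κ : Matrix (P × Unit) (P × Unit) ℂ} (hκ : IsState κ) :
    ((Real.logb 2 (Fintype.card Q) - Real.logb 2 (Fintype.card P) : ℝ) : EReal) ≤
      HminDown (N κ) := by
  have hP : Nonempty P := hκ.nonempty.map Prod.fst
  have hPR : (0 : ℝ) < Fintype.card P := by exact_mod_cast Fintype.card_pos (α := P)
  have hQR : (0 : ℝ) < Fintype.card Q := by exact_mod_cast Fintype.card_pos (α := Q)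
  obtain ⟨E, -, hE⟩ := hN.exists_trFst_eq
  have hUnit : ∀ {X : Matrix Unit Unit ℂ}, IsState X → X = 1 := by
    intro X hX
    ext i j
    simpa [trace] using hX.2
  have hu : IsState (uniform P ⊗ₖ (1 : Matrix Unit Unit ℂ)) :=
    ⟨uniform_isState.1.kronecker PosSemidef.one, by
      rw [trace_kronecker, uniform_isState.2, trace_one]; simp⟩
  have h1 : N (uniform P ⊗ₖ (1 : Matrix Unit Unit ℂ)) = uniform Q ⊗ₖ trFst (N κ) := by
    rw [hN.apply_uniform_kronecker, hE, hE, hUnit hu.trFst, hUnit hκ.trFst]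
  have h2 : N κ ≤ N 1 := by
    rw [Matrix.le_iff, ← map_sub]
    exact hN.posSemidef (Matrix.le_iff.mp hκ.le_one)
  have h3 : (1 : Matrix (P × Unit) (P × Unit) ℂ) =
      (Fintype.card P : ℂ) • (uniform P ⊗ₖ (1 : Matrix Unit Unit ℂ)) := by
    have : (Fintype.card P : ℂ) ≠ 0 := by exact_mod_cast Fintype.card_ne_zero
    rw [uniform, smul_kronecker, smul_smul, mul_inv_cancel₀ this, one_smul, one_kronecker_one]
  rw [h3, map_smul, h1, uniform_kronecker] at h2
  rw [coe_le_HminDown_iff (hN.isState hκ), neg_sub, Real.rpow_sub two_pos,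
    Real.rpow_logb two_pos (by norm_num) hPR, Real.rpow_logb two_pos (by norm_num) hQR]
  convert h2 using 1
  ext i j
  simp [div_eq_mul_inv, mul_assoc]

end PrepareBound

section Work
variable {A : Type u} {B : Type v} [Fintype A] [DecidableEq A] [Fintype B] [DecidableEq B]

omit [Fintype A] in
theorem withBattery_ket (m : ℕ) [NeZero m] (a₀ : A) :
    withBattery m (ket ((a₀, ()) : A × Unit)) = ket (((0 : Fin m), a₀), ()) := by
  ext ⟨⟨i, a⟩, b⟩ ⟨⟨i', a'⟩, b'⟩
  simp [withBattery, ket, single_apply, Prod.ext_iff, ite_and]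
  split_ifs <;> simp_all

theorem withBattery_isState (m : ℕ) [NeZero m] {ρ : Matrix (A × B) (A × B) ℂ} (hρ : IsState ρ) :
    IsState (withBattery m ρ) := by
  rw [withBattery_eq_embed]
  exact embed_isState _ hρ

omit [DecidableEq A] in
theorem card_battery (m : ℕ) : ((Fintype.card (Fin m × A) : ℕ) : ℝ) = m * Fintype.card A := by
  simp

/-- The work values of the free operations that convert `ρ` into `σ` up to `ε`. -/
def workValues {A' : Type w} {B' : Type x} [Fintype A'] [DecidableEq A'] [Fintype B']
    [DecidableEq B'] (ε : ℝ) (ρ : Matrix (A × B) (A × B) ℂ)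
    (σ : Matrix (A' × B') (A' × B') ℂ) : Set EReal :=
  {c : EReal | ∃ (m n : ℕ) (_ : NeZero m) (_ : NeZero n)
    (N : Matrix ((Fin m × A) × B) ((Fin m × A) × B) ℂ →ₗ[ℂ]
      Matrix ((Fin n × A') × B') ((Fin n × A') × B') ℂ),
    IsCUCO N ∧ traceDist (withBattery n σ) (N (withBattery m ρ)) ≤ ε ∧
    c = ((Real.logb 2 m - Real.logb 2 n : ℝ) : EReal)}

omit [DecidableEq B] in
theorem sInf_workValues_le {A' : Type w} {B' : Type x} [Fintype A'] [DecidableEq A'] [Fintype B']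
    [DecidableEq B'] {ε : ℝ} {ρ : Matrix (A × B) (A × B) ℂ} {σ : Matrix (A' × B') (A' × B') ℂ}
    {m n : ℕ} [hm : NeZero m] [hn : NeZero n]
    {N : Matrix ((Fin m × A) × B) ((Fin m × A) × B) ℂ →ₗ[ℂ]
      Matrix ((Fin n × A') × B') ((Fin n × A') × B') ℂ} (hN : IsCUCO N)
    (hd : traceDist (withBattery n σ) (N (withBattery m ρ)) ≤ ε) {z : ℝ}
    (hz : Real.logb 2 m - Real.logb 2 n ≤ z) : sInf (workValues ε ρ σ) ≤ (z : EReal) :=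
  (sInf_le (show ((Real.logb 2 m - Real.logb 2 n : ℝ) : EReal) ∈ workValues ε ρ σ from
    ⟨m, n, hm, hn, N, hN, hd, rfl⟩)).trans (EReal.coe_le_coe_iff.mpr hz)

omit [DecidableEq A] in
/-- An embedding of `A` into a larger `A'` and the adjunction of a battery to `A` extend to a
common system. -/
theorem exists_embedding_extend_battery {l n : ℕ} [NeZero n] (f : A ↪ Fin l) (a₀ : A)
    (hn : l + 1 ≤ n) : ∃ g : Fin l ↪ Fin n × A, f.trans g = batteryEmbedding A n := by
  classical
  have h1 : ∀ i : Fin l, i.val + 1 < n := fun i => by omega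
  -- points outside the range of `f` go to distinct battery levels other than the ground level
  let g : Fin l → Fin n × A := fun i =>
    if h : ∃ a, f a = i then (0, h.choose) else (⟨i.val + 1, h1 i⟩, a₀)
  have hg : Function.Injective g := by
    intro i j hij
    simp only [g] at hij
    split_ifs at hij with hi hj hj
    · rw [← hi.choose_spec, ← hj.choose_spec, show hi.choose = hj.choose from (Prod.ext_iff.mp hij).2]
    · have := congrArg Fin.val (Prod.ext_iff.mp hij).1
      simp at this
    · have := congrArg Fin.val (Prod.ext_iff.mp hij).1
      simp at this
    · have := congrArg Fin.val (Prod.ext_iff.mp hij).1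
      exact Fin.ext (by simpa using this)
  refine ⟨⟨g, hg⟩, ?_⟩
  ext1 a
  have h : ∃ a', f a' = f a := ⟨a, rfl⟩
  have : g (f a) = (0, h.choose) := dif_pos h
  rw [Function.Embedding.trans_apply, batteryEmbedding_apply]
  exact this.trans (by rw [f.injective h.choose_spec])

/-- The infimum is not attained in general: a state `τ` of min-entropy `h` is reached through
ratios `m / n` slightly above `2 ^ (-h)`. -/
theorem sInf_workValues_prepare (a₀ : A) {ρ : Matrix (A × B) (A × B) ℂ} (hρ : IsState ρ) (ε : ℝ) :
    sInf (workValues ε (ket ((a₀, ()) : A × Unit)) ρ) = -HminDownSmooth ε ρ := by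
  have hA : Nonempty A := ⟨a₀⟩
  have hAR : (0 : ℝ) < Fintype.card A := by exact_mod_cast Fintype.card_pos (α := A)
  refine le_antisymm ?_ (le_sInf ?_)
  · rw [EReal.le_neg]
    refine sSup_le ?_
    rintro _ ⟨l, f, τ, hτ, hd, rfl⟩
    rw [EReal.le_neg, ← EReal.le_of_forall_lt_iff_le]
    intro z hz
    obtain ⟨y, hy1, hy2⟩ := EReal.lt_iff_exists_real_btwn.mp hz
    obtain ⟨m, n, hm, hln, hn2, hmn1, hmn2⟩ := exists_ratio_between
      (Real.rpow_pos_of_pos two_pos y)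
      (Real.rpow_lt_rpow_of_exponent_lt one_lt_two (EReal.coe_lt_coe_iff.mp hy2)) (l + 1)
    have : NeZero m := ⟨by omega⟩
    have : NeZero n := ⟨by omega⟩
    have hmR : (0 : ℝ) < m := by exact_mod_cast (by omega : 0 < m)
    have hnR : (0 : ℝ) < n := by exact_mod_cast (by omega : 0 < n)
    obtain ⟨g, hg⟩ := exists_embedding_extend_battery f a₀ hln
    have hy : ((-y : ℝ) : EReal) ≤ HminDown (embed g τ) := by
      rw [HminDown_embed g hτ, EReal.coe_neg, EReal.neg_le]
      exact hy1.le
    rw [coe_le_HminDown_iff (embed_isState g hτ), neg_neg] at hy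
    have hle : embed g τ ≤
        ((Fintype.card (Fin m × A) : ℕ) : ℝ) • (uniform (Fin n × A) ⊗ₖ trFst (embed g τ)) := by
      refine hy.trans ?_
      have hpsd := (one_kronecker_posSemidef (A := Fin n × A)
        (embed_isState g hτ).trFst.1).smul (sub_nonneg.mpr hmn1)
      rw [sub_smul] at hpsd
      rw [Matrix.le_iff]
      have e : ((Fintype.card (Fin m × A) : ℕ) : ℝ) *
          ((Fintype.card (Fin n × A) : ℕ) : ℝ)⁻¹ = (m : ℝ) / n := by
        rw [card_battery, card_battery]
        field_simp
      rwa [uniform_kronecker, smul_smul, e]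
    obtain ⟨N, hN, hNk⟩ := exists_isCUCO_prepare ((0 : Fin m), a₀) (by
      rw [Fintype.card_prod, Fintype.card_fin]
      exact hm.trans (Nat.le_mul_of_pos_right m Fintype.card_pos)) (embed_isState g hτ) hle
    refine sInf_workValues_le hN ?_ ?_
    · rw [withBattery_ket, hNk, withBattery_eq_embed, ← hg, ← embed_embed]
      exact (traceDist_embed_le g (embed_isState f hρ).1.1 hτ.1.1).trans hd
    · rw [← Real.logb_div hmR.ne' hnR.ne',
        Real.logb_le_iff_le_rpow one_lt_two (div_pos hmR hnR)]
      exact hmn2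
  · rintro _ ⟨m, n, _, _, N, hN, hd, rfl⟩
    have hmR : (0 : ℝ) < m := by exact_mod_cast Nat.pos_of_ne_zero (NeZero.ne m)
    have hnR : (0 : ℝ) < n := by exact_mod_cast Nat.pos_of_ne_zero (NeZero.ne n)
    have hκ : IsState (withBattery m (ket ((a₀, ()) : A × Unit))) :=
      withBattery_isState m (ket_isState _)
    set τ := N (withBattery m (ket ((a₀, ()) : A × Unit))) with hτd
    have hτ : IsState τ := hN.isState hκ
    have h1 := hN.le_HminDown hκ
    rw [card_battery, card_battery, Real.logb_mul hmR.ne' hAR.ne',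
      Real.logb_mul hnR.ne' hAR.ne', add_sub_add_right_eq_sub, ← hτd] at h1
    -- the output itself, with the final battery as part of `A'`, competes in the smoothing
    let e := (Fintype.equivFin (Fin n × A)).toEmbedding
    have h2 : HminDown (embed e τ) ≤ HminDownSmooth ε ρ := by
      refine le_sSup ⟨_, (batteryEmbedding A n).trans e, embed e τ, embed_isState e hτ, ?_, rfl⟩
      rw [← embed_embed, ← withBattery_eq_embed]
      exact (traceDist_embed_le e (withBattery_isState n hρ).1.1 hτ.1.1).trans hd
    rw [HminDown_embed e hτ] at h2
    rw [EReal.neg_le, ← EReal.coe_neg, neg_sub]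
    exact h1.trans h2

/-- The test on `AB` that accepts when a free operation maps `ρ` to the target state `κ`. -/
theorem IsCUCO.exists_test_mem {Q : Type w} [Fintype Q] [DecidableEq Q] [Nonempty A] [Nonempty Q]
    {m : ℕ} [NeZero m]
    {N : Matrix ((Fin m × A) × B) ((Fin m × A) × B) ℂ →ₗ[ℂ] Matrix (Q × Unit) (Q × Unit) ℂ}
    (hN : IsCUCO N) (q : Q) {ρ : Matrix (A × B) (A × B) ℂ} (hρ : IsState ρ) {ε : ℝ}
    (hd : traceDist (ket (q, ())) (N (withBattery m ρ)) ≤ ε) :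
    ∃ Λ ∈ tests ε ρ, ∀ σ : Matrix B B ℂ, IsState σ →
      (Λ * ((1 : Matrix A A ℂ) ⊗ₖ σ)).trace.re ≤ m * Fintype.card A / Fintype.card Q := by
  have hκ : IsState (ket (q, ()) : Matrix (Q × Unit) (Q × Unit) ℂ) := ket_isState _
  set κ : Matrix (Q × Unit) (Q × Unit) ℂ := ket (q, ()) with hκd
  let φ : Matrix (A × B) (A × B) ℂ →ₗ[ℂ] ℂ :=
    { toFun := fun X => (κ * N (embed (batteryEmbedding A m) X)).trace
      map_add' := fun X Y => by
        simp only [embed_eq, Matrix.mul_add, Matrix.add_mul, map_add, trace_add]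
      map_smul' := fun c X => by
        simp only [embed_eq, Matrix.mul_smul, Matrix.smul_mul, map_smul, trace_smul,
          RingHom.id_apply] }
  have hpos : ∀ X : Matrix (A × B) (A × B) ℂ, X.PosSemidef →
      (N (embed (batteryEmbedding A m) X)).PosSemidef :=
    fun X hX => hN.posSemidef (embed_posSemidef _ hX)
  obtain ⟨Λ, h0, h1, hΛ⟩ := exists_test_of_functional φ
    (fun X hX => trace_mul_nonneg hκ.1 (hpos X hX)) (fun X hX => by
      have h := trace_mul_nonneg (Matrix.le_iff.mp hκ.le_one) (hpos X hX)
      rw [sub_mul, one_mul, trace_sub, hN.trace_eq, embed_trace, sub_nonneg] at h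
      exact h)
  refine ⟨Λ, ⟨h0, h1, ?_⟩, fun σ hσ => ?_⟩
  · have h := trace_mul_re_sub_le_traceDist hκ (hN.isState (withBattery_isState m hρ))
      hκ.1.nonneg hκ.le_one
    rw [hκd, ket_mul_self, ← hκd, hκ.2, withBattery_eq_embed] at h
    rw [withBattery_eq_embed] at hd
    have e : (Λ * ρ).trace = (κ * N (embed (batteryEmbedding A m) ρ)).trace := hΛ ρ
    rw [e]
    rw [Complex.one_re] at h
    linarith
  · have e : (Λ * ((1 : Matrix A A ℂ) ⊗ₖ σ)).trace =
        (κ * N (embed (batteryEmbedding A m) ((1 : Matrix A A ℂ) ⊗ₖ σ))).trace := hΛ _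
    have hle := embed_one_kronecker_le (batteryEmbedding A m) hσ.1
    have hle' : N (embed (batteryEmbedding A m) ((1 : Matrix A A ℂ) ⊗ₖ σ)) ≤
        N ((1 : Matrix (Fin m × A) (Fin m × A) ℂ) ⊗ₖ σ) := by
      rw [Matrix.le_iff, ← map_sub]
      exact hN.posSemidef (Matrix.le_iff.mp hle)
    have hc : ((Fintype.card (Fin m × A) : ℕ) : ℂ) ≠ 0 := by exact_mod_cast Fintype.card_ne_zero
    have hone : (1 : Matrix (Fin m × A) (Fin m × A) ℂ) ⊗ₖ σ =
        ((Fintype.card (Fin m × A) : ℕ) : ℂ) • (uniform (Fin m × A) ⊗ₖ σ) := by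
      rw [uniform, smul_kronecker, smul_smul, mul_inv_cancel₀ hc, one_smul]
    have hus : IsState (uniform (Fin m × A) ⊗ₖ σ) := ⟨uniform_isState.1.kronecker hσ.1, by
      rw [trace_kronecker, uniform_isState.2, hσ.2, one_mul]⟩
    have hval : (κ * N (uniform (Fin m × A) ⊗ₖ σ)).trace = (Fintype.card Q : ℂ)⁻¹ := by
      rw [hN.apply_uniform_kronecker]
      have h1 := (hN.isState hus).trFst.2
      generalize trFst (N (uniform (Fin m × A) ⊗ₖ σ)) = X at h1 ⊢
      simp only [trace, diag, Finset.univ_unique, Finset.sum_singleton] at h1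
      simp [hκd, ket, trace_single_mul, uniform, h1]
    have hfin := trace_mul_re_nonneg hκ.1 (Matrix.le_iff.mp hle')
    rw [mul_sub, trace_sub, hone, map_smul, Matrix.mul_smul, trace_smul, hval, Complex.sub_re,
      ← e] at hfin
    have : (((Fintype.card (Fin m × A) : ℕ) : ℂ) • (Fintype.card Q : ℂ)⁻¹).re =
        m * Fintype.card A / Fintype.card Q := by
      rw [← card_battery, smul_eq_mul, div_eq_mul_inv, ← Complex.ofReal_natCast,
        ← Complex.ofReal_natCast, ← Complex.ofReal_inv, ← Complex.ofReal_mul, Complex.ofReal_re]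
    rw [this] at hfin
    linarith

/-- The infimum is approached through ratios `m / n` slightly above the weight `2 ^ y` of a test
that is good for all states of Bob at once. -/
theorem sInf_workValues_erase (a₀ : A) {ρ : Matrix (A × B) (A × B) ℂ} (hρ : IsState ρ) (ε : ℝ) :
    sInf (workValues ε ρ (ket ((a₀, ()) : A × Unit))) = HmaxUpSmooth ε ρ := by
  have hA : Nonempty A := ⟨a₀⟩
  have hB : Nonempty B := hρ.nonempty.map Prod.snd
  have hAR : (0 : ℝ) < Fintype.card A := by exact_mod_cast Fintype.card_pos (α := A)
  refine le_antisymm ?_ (le_sInf ?_)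
  · rw [← EReal.le_of_forall_lt_iff_le]
    intro z hz
    obtain ⟨y, hy1, hy2⟩ := EReal.lt_iff_exists_real_btwn.mp hz
    obtain ⟨Λ, ⟨h0, h1, hacc⟩, hΛ⟩ := exists_test_of_HmaxUpSmooth_lt hy1
    obtain ⟨m, n, hm, -, hn2, hmn1, hmn2⟩ := exists_ratio_between
      (Real.rpow_pos_of_pos two_pos y)
      (Real.rpow_lt_rpow_of_exponent_lt one_lt_two (EReal.coe_lt_coe_iff.mp hy2)) 0
    have : NeZero m := ⟨by omega⟩
    have : NeZero n := ⟨by omega⟩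
    have hmR : (0 : ℝ) < m := by exact_mod_cast (by omega : 0 < m)
    have hnR : (0 : ℝ) < n := by exact_mod_cast (by omega : 0 < n)
    have hcard : 2 ≤ Fintype.card (Fin n × A) := by
      rw [Fintype.card_prod, Fintype.card_fin]
      exact hn2.trans (Nat.le_mul_of_pos_right n Fintype.card_pos)
    have htr : trFst Λ ≤ ((m * Fintype.card A : ℝ) / ((Fintype.card (Fin n × A) : ℕ) : ℝ)) • 1 := by
      refine le_smul_one_of_forall_state (trFst_posSemidef h0.posSemidef) fun σ hσ => ?_
      rw [← trace_mul_one_kronecker, card_battery, mul_div_mul_right _ _ hAR.ne']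
      exact (hΛ σ hσ).trans hmn1
    obtain ⟨N, hN, hNρ⟩ := exists_isCUCO_erase m hm ((0 : Fin n), a₀) hcard h0 h1 htr
    refine sInf_workValues_le hN ?_ ?_
    · rw [withBattery_ket]
      have hp : 0 ≤ 1 - (Λ * ρ).trace := by
        have := trace_mul_nonneg (Matrix.le_iff.mp h1) hρ.1
        rwa [sub_mul, one_mul, trace_sub, hρ.2] at this
      let e : Fin n × A → (Fin n × A) × Unit := fun q => (q, ())
      have hT := uniformCompl_isState ((0 : Fin n), a₀) hcard
      have hκ := ket_isState ((0 : Fin n), a₀)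
      refine (traceDist_le_of_sub_eq
        (P := (1 - (Λ * ρ).trace) • (ket ((0 : Fin n), a₀)).submatrix Prod.fst Prod.fst)
        (Q := (1 - (Λ * ρ).trace) • (uniformCompl ((0 : Fin n), a₀)).submatrix Prod.fst Prod.fst)
        ((hκ.1.submatrix _).smul hp) ((hT.1.submatrix _).smul hp) ?_).trans ?_
      · ext ⟨i, _⟩ ⟨j, _⟩
        have hk : ket (((0 : Fin n), a₀), ()) (i, ()) (j, ()) = ket ((0 : Fin n), a₀) i j := by
          simp [ket, single_apply]
        rw [Matrix.sub_apply, hNρ, hρ.2, hk]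
        simp only [Matrix.add_apply, Matrix.sub_apply, Matrix.smul_apply, submatrix_apply,
          smul_eq_mul]
        ring
      · have htr' : ∀ M : Matrix (Fin n × A) (Fin n × A) ℂ,
            (M.submatrix Prod.fst Prod.fst : Matrix ((Fin n × A) × Unit) _ ℂ).trace = M.trace := by
          intro M
          simp [trace, Fintype.sum_prod_type (α₁ := Fin n × A)]
        rw [trace_smul, trace_smul, htr', htr', hκ.2, hT.2]
        simp only [smul_eq_mul, mul_one, Complex.sub_re, Complex.one_re]
        linarith
    · rw [← Real.logb_div hmR.ne' hnR.ne',
        Real.logb_le_iff_le_rpow one_lt_two (div_pos hmR hnR)]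
      exact hmn2
  · rintro _ ⟨m, n, _, _, N, hN, hd, rfl⟩
    have hmR : (0 : ℝ) < m := by exact_mod_cast Nat.pos_of_ne_zero (NeZero.ne m)
    have hnR : (0 : ℝ) < n := by exact_mod_cast Nat.pos_of_ne_zero (NeZero.ne n)
    rw [withBattery_ket] at hd
    obtain ⟨Λ, hΛ, hb⟩ := hN.exists_test_mem _ hρ hd
    rw [card_battery, mul_div_mul_right _ _ hAR.ne'] at hb
    rw [← Real.logb_div hmR.ne' hnR.ne']
    exact HmaxUpSmooth_le (div_pos hmR hnR) hΛ hb

end Work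
end QThermo
end

theorem theorem1 {A B : Type*} [Fintype A] [DecidableEq A] [Fintype B] [DecidableEq B]
    (a₀ : A) (β : ℝ) (hβ : 0 < β)
    (ρ : Matrix (A × B) (A × B) ℂ) (hρ : QThermo.IsState ρ) :
    (∀ ε : ℝ, 0 ≤ ε → ε ≤ 1 →
      QThermo.prepCost β ε a₀ ρ = -(((1 / β : ℝ) : EReal) * QThermo.HminDownSmooth ε ρ) ∧
      QThermo.erasCost β ε a₀ ρ = ((1 / β : ℝ) : EReal) * QThermo.HmaxUpSmooth ε ρ) ∧
    QThermo.prepCost β 0 a₀ ρ = -(((1 / β : ℝ) : EReal) * QThermo.HminDown ρ) ∧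
    QThermo.erasCost β 0 a₀ ρ = ((1 / β : ℝ) : EReal) * QThermo.HmaxUp ρ := by
  have hprep : ∀ ε : ℝ,
      QThermo.prepCost β ε a₀ ρ = -(((1 / β : ℝ) : EReal) * QThermo.HminDownSmooth ε ρ) := by
    intro ε
    rw [← mul_neg, ← QThermo.sInf_workValues_prepare a₀ hρ ε]
    rfl
  have heras : ∀ ε : ℝ,
      QThermo.erasCost β ε a₀ ρ = ((1 / β : ℝ) : EReal) * QThermo.HmaxUpSmooth ε ρ := by
    intro ε
    rw [← QThermo.sInf_workValues_erase a₀ hρ ε]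
    rfl
  refine ⟨fun ε _ _ => ⟨hprep ε, heras ε⟩, ?_, ?_⟩
  · rw [hprep, QThermo.HminDownSmooth_zero hρ]
  · rw [heras, QThermo.HmaxUpSmooth_zero hρ]
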